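/- Let $k$ be a commutative ring. Unadorned rings are $k$-algebras (associative, unital, not necessarily commutative). **Hopf algebroids.** A *right bialgebroid* over a $k$-algebra $R$ with total $k$-algebra $H$ consists of $k$-algebra maps $s:R\to H$ and $t:R^{op}\to H$ with commuting ranges, and an $R$-coring structure $(\Delta,\epsilon)$ on $H$ with respect to the bimodule structure $r h r'=h\,s(r')t(r)$, such that: $\Delta$ has its range in the Takeuchi product $H\times_R H=\{\sum_i h_i\otimes_R h_i'\mid \sum_i s(r)h_i\otimes_R h'_i=\sum_i h_i\otimes_R t(r)h_i'\ \forall r\in R\}$ and is multiplicative with respect to the factorwise product, $\Delta(s(r)t(r'))=t(r')\otimes_R s(r)$; and $h\mapsto\epsilon(s(-)h)$ is a ring map $H\to \mathrm{End}_k(R)^{op}$ sending $s(r)t(r')$ to $r'(-)r$. A *left bialgebroid* over $L$ is defined symmetrically, with $l h l'=s(l)t(l')h$, Takeuchi condition $\sum_i h_i t(l)\otimes_L h_i'=\sum_i h_i\otimes_L h_i's(l)$, $\Delta(s(l)t(l'))=s(l)\otimes_L t(l')$, and the ring map $h\mapsto\epsilon(h\,s(-))$, $H\to\mathrm{End}_k(L)$,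 sending $s(l)t(l')$ to $l(-)l'$. A *Hopf algebroid* $\mathcal H$ consists of a left bialgebroid $(H,s_L,t_L,\Delta_L,\epsilon_L)$ over $L$ and a right bialgebroid $(H,s_R,t_R,\Delta_R,\epsilon_R)$ over $R$ on the same $k$-algebra $H$, with a $k$-module map $S:H\to H$ (the antipode, not assumed to be bijective), such that $$s_L\epsilon_Lt_R=t_R,\quad t_L\epsilon_Ls_R=s_R,\quad s_R\epsilon_Rt_L=t_L,\quad t_R\epsilon_Rs_L=s_L,$$ $$(\Delta_L\otimes_RH)\Delta_R=(H\otimes_L\Delta_R)\Delta_L,\qquad(\Delta_R\otimes_LH)\Delta_L=(H\otimes_R\Delta_L)\Delta_R,$$ $$S(t_L(l)\,h\,t_R(r))=s_R(r)S(h)s_L(l),\qquad \mu(S\otimes_LH)\Delta_L=s_R\epsilon_R,\qquad \mu(H\otimes_RS)\Delta_R=s_L\epsilon_L .$$ **Comodules.** A *right $\mathcal H$-comodule* is a right $R$-module and right $L$-module $M$ with a coaction $\varrho_R:M\to M\otimes_RH$ of the coring $(H,\Delta_R,\epsilon_R)$ and a coaction $\varrho_L:M\to M\otimes_LH$ of the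 coring $(H,\Delta_L,\epsilon_L)$ such that $\varrho_R$ is right $L$-linear, $\varrho_L$ is right $R$-linear, $(M\otimes_R\Delta_L)\varrho_R=(\varrho_R\otimes_LH)\varrho_L$ and $(M\otimes_L\Delta_R)\varrho_L=(\varrho_L\otimes_RH)\varrho_R$. Morphisms are the $R$- and $L$-linear maps compatible with both coactions; they form a category $\mathcal M^{\mathcal H}$. Write $\varrho_R(m)=m^{[0]}\otimes_R m^{[1]}$ and $\varrho_L(m)=m_{[0]}\otimes_L m_{[1]}$. This category is monoidal: a comodule $N$ is an $R$-bimodule with $rn=n^{[0]}\epsilon_R(s_R(r)n^{[1]})$, the product is $M\otimes_RN$ with coactions $m\otimes n\mapsto (m^{[0]}\otimes n^{[0]})\otimes_R m^{[1]}n^{[1]}$ and $m\otimes n\mapsto (m_{[0]}\otimes n_{[0]})\otimes_L m_{[1]}n_{[1]}$, and the unit is $R$ with coactions $r\mapsto 1\otimes s_R(r)$. A *right $\mathcal H$-comodule algebra* $A$ is a monoid in $\mathcal M^{\mathcal H}$; in particular it is an $R$-ring, with unit map $\eta_R:R\to A$. The total algebra $H$ is one, with $\eta_R=s_R$ and coactions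 $\Delta_R$, $\Delta_L$. A *right-right relative Hopf module* is a right module of the monoid $A$ in $\mathcal M^{\mathcal H}$; their category is $\mathcal M^{\mathcal H}_A$. The *$\mathcal H_R$-coinvariants* of $A$ are the elements $b\in A$ such that $\varrho_R(ba)=b\varrho_R(a)$ for all $a\in A$. **Cleft extensions.** Let $A$ be a right $\mathcal H$-comodule algebra and $B$ the subalgebra of its $\mathcal H_R$-coinvariants. The extension $B\subseteq A$ is *$\mathcal H$-cleft* if there are a $k$-algebra map $\eta_L:L\to A$ with range in $B$, a left $L$-linear morphism of right $\mathcal H$-comodules $j:H\to A$ (that is, $j(s_L(l)h)=\eta_L(l)j(h)$), called a *cleaving map*, and a $k$-linear map $\widetilde j:H\to A$ with $\widetilde j(t_L(l)\,h\,t_R(r))=\eta_R(r)\widetilde j(h)\eta_L(l)$, called its inverse, such that $$\mu(j\otimes_R\widetilde j)\Delta_R=\eta_L\epsilon_L,\qquad \mu(\widetilde j\otimes_Lj)\Delta_L=\eta_R\epsilon_R .$$ **Theorem.** Let $\mathcal H$ be any Hopf algebroid. 1. The source map $s_L:L\to H$ is injective, and $s_L(L)=t_R(R)$ is the set of $\mathcal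 H_R$-coinvariants of $H$. The extension $L\subseteq H$ given by $s_L$ is $\mathcal H$-cleft, with $\eta_L=s_L$, cleaving map the identity map of $H$, and inverse the antipode $S$. 2. (Fundamental Theorem of Hopf modules) The functor $-\otimes_LH:\mathcal M_L\to\mathcal M^{\mathcal H}_H$ is an equivalence of categories. Here $L$ acts on the left of $H$ by $s_L$, the coactions on $W\otimes_LH$ are $W\otimes_L\Delta_R$ and $W\otimes_L\Delta_L$, and $(w\otimes_Lh)h'=w\otimes_Lhh'$. -/

import Mathlib

open MulOpposite CategoryTheory
open scoped TensorProduct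

universe uk uL uR uH w

/-! ### Actions and tensor products over a non-commutative ring

The total algebra of a Hopf algebroid carries several module structures at the same time, so
actions are explicit terms and not type class instances.  Modules over a `k`-algebra `A` are
modules over the ring `A`; their `k`-module structure is the restriction along `k → A`. -/

/-- A left `A`-module structure on the abelian group `M`; the element `a m` is `act a m`. -/
@[ext] structure LeftAct (A M : Type*) [Ring A] [AddCommGroup M] where
  act : A →+ M →+ M
  one_act : ∀ m, act 1 m = m
  mul_act : ∀ a b m, act (a * b) m = act a (act b m)

/-- A right `A`-module structure on the abelian group `M`; the element `m a` is `act a m`. -/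
@[ext] structure RightAct (A M : Type*) [Ring A] [AddCommGroup M] where
  act : A →+ M →+ M
  one_act : ∀ m, act 1 m = m
  mul_act : ∀ a b m, act (a * b) m = act b (act a m)

section BTensor

variable {A B M M' N N' P : Type*} [Ring A] [Ring B]
  [AddCommGroup M] [AddCommGroup M'] [AddCommGroup N] [AddCommGroup N'] [AddCommGroup P]

/-- The subgroup generated by all `m a ⊗ n - m ⊗ a n`. -/
def BTensor.rel (ρ : RightAct A M) (lam : LeftAct A N) : AddSubgroup (M ⊗[ℤ] N) :=
  AddSubgroup.closure
    {x | ∃ (a : A) (m : M) (n : N), x = ρ.act a m ⊗ₜ[ℤ] n - m ⊗ₜ[ℤ] lam.act a n}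

/-- The tensor product `M ⊗_A N` of a right `A`-module and a left `A`-module. -/
def BTensor (ρ : RightAct A M) (lam : LeftAct A N) := (M ⊗[ℤ] N) ⧸ BTensor.rel ρ lam

namespace BTensor

instance (ρ : RightAct A M) (lam : LeftAct A N) : AddCommGroup (BTensor ρ lam) :=
  inferInstanceAs (AddCommGroup ((M ⊗[ℤ] N) ⧸ BTensor.rel ρ lam))

variable {ρ : RightAct A M} {lam : LeftAct A N} {ρ' : RightAct A M'} {lam' : LeftAct A N'}

/-- The quotient map `M ⊗_ℤ N → M ⊗_A N`. -/
def proj (ρ : RightAct A M) (lam : LeftAct A N) : M ⊗[ℤ] N →+ BTensor ρ lam :=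
  QuotientAddGroup.mk' (BTensor.rel ρ lam)

/-- The elementary tensor `m ⊗_A n`. -/
def mk (ρ : RightAct A M) (lam : LeftAct A N) : M →+ N →+ BTensor ρ lam :=
  AddMonoidHom.mk' (fun m => AddMonoidHom.mk' (fun n => proj ρ lam (m ⊗ₜ[ℤ] n))
      (fun n n' => by rw [TensorProduct.tmul_add, map_add]))
    (fun m m' => AddMonoidHom.ext fun n =>
      (congrArg (proj ρ lam) (TensorProduct.add_tmul m m' n)).trans (map_add _ _ _))

theorem mk_balanced (a : A) (m : M) (n : N) :
    mk ρ lam (ρ.act a m) n = mk ρ lam m (lam.act a n) := by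
  refine (QuotientAddGroup.eq_iff_sub_mem).2 ?_
  exact AddSubgroup.subset_closure ⟨a, m, n, rfl⟩

theorem induction_on {p : BTensor ρ lam → Prop} (x : BTensor ρ lam)
    (zero : p 0) (tmul : ∀ m n, p (mk ρ lam m n))
    (add : ∀ x y, p x → p y → p (x + y)) : p x := by
  obtain ⟨z, rfl⟩ : ∃ z, proj ρ lam z = x := QuotientAddGroup.mk'_surjective _ x
  induction z with
  | zero => rw [map_zero]; exact zero
  | tmul m n => exact tmul m n
  | add x y hx hy => rw [map_add]; exact add _ _ hx hy

theorem hom_ext {f g : BTensor ρ lam →+ P}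
    (h : ∀ m n, f (mk ρ lam m n) = g (mk ρ lam m n)) : f = g := by
  ext x
  induction x using induction_on with
  | zero => simp
  | tmul m n => exact h m n
  | add x y hx hy => simp [hx, hy]

/-- The additive map on `M ⊗_A N` induced by an `A`-balanced biadditive map. -/
def lift (f : M →+ N →+ P) (hf : ∀ (a : A) m n, f (ρ.act a m) n = f m (lam.act a n)) :
    BTensor ρ lam →+ P :=
  QuotientAddGroup.lift (BTensor.rel ρ lam)
    (TensorProduct.liftAddHom f (fun z m n => by simp))
    (by
      unfold BTensor.rel
      rw [AddSubgroup.closure_le]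
      rintro _ ⟨a, m, n, rfl⟩
      simp [hf, AddMonoidHom.mem_ker])

@[simp] theorem lift_mk (f : M →+ N →+ P) (hf) (m : M) (n : N) :
    lift (ρ := ρ) (lam := lam) f hf (mk ρ lam m n) = f m n := rfl

/-- `f ⊗_A g` for a right `A`-linear map `f` and a left `A`-linear map `g`. -/
def map (f : M →+ M') (g : N →+ N')
    (hf : ∀ a m, f (ρ.act a m) = ρ'.act a (f m))
    (hg : ∀ a n, g (lam.act a n) = lam'.act a (g n)) : BTensor ρ lam →+ BTensor ρ' lam' :=
  lift (((mk ρ' lam').comp f).compl₂ g) (fun a m n => by simp [hf, hg, mk_balanced])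

@[simp] theorem map_mk (f : M →+ M') (g : N →+ N') (hf) (hg) (m : M) (n : N) :
    map (ρ := ρ) (lam := lam) (ρ' := ρ') (lam' := lam') f g hf hg (mk ρ lam m n) =
      mk ρ' lam' (f m) (g n) := rfl

/-- `f ⊗_A N`. -/
def rTensor (lam : LeftAct A N) (f : M →+ M')
    (hf : ∀ a m, f (ρ.act a m) = ρ'.act a (f m)) : BTensor ρ lam →+ BTensor ρ' lam :=
  map f (AddMonoidHom.id N) hf (fun _ _ => rfl)

/-- `M ⊗_A g`. -/
def lTensor (ρ : RightAct A M) (g : N →+ N')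
    (hg : ∀ a n, g (lam.act a n) = lam'.act a (g n)) : BTensor ρ lam →+ BTensor ρ lam' :=
  map (AddMonoidHom.id M) g (fun _ _ => rfl) hg

@[simp] theorem rTensor_mk (f : M →+ M') (hf) (m : M) (n : N) :
    rTensor (ρ := ρ) (ρ' := ρ') lam f hf (mk ρ lam m n) = mk ρ' lam (f m) n := rfl

@[simp] theorem lTensor_mk (g : N →+ N') (hg) (m : M) (n : N) :
    lTensor (lam := lam) (lam' := lam') ρ g hg (mk ρ lam m n) = mk ρ lam' m (g n) := rfl

theorem rTensor_id (x : BTensor ρ lam) :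
    rTensor (ρ' := ρ) lam (AddMonoidHom.id M) (fun _ _ => rfl) x = x := by
  induction x using induction_on with
  | zero => simp only [map_zero]
  | tmul m n => rfl
  | add x y hx hy => rw [map_add, hx, hy]

theorem rTensor_comp {M'' : Type*} [AddCommGroup M''] {ρ'' : RightAct A M''} (f : M →+ M')
    (g : M' →+ M'') (hf : ∀ a m, f (ρ.act a m) = ρ'.act a (f m))
    (hg : ∀ a m, g (ρ'.act a m) = ρ''.act a (g m))
    (h : ∀ a m, (g.comp f) (ρ.act a m) = ρ''.act a ((g.comp f) m)) (x : BTensor ρ lam) :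
    rTensor (ρ' := ρ'') lam (g.comp f) h x =
      rTensor (ρ' := ρ'') lam g hg (rTensor (ρ' := ρ') lam f hf x) := by
  induction x using induction_on with
  | zero => simp only [map_zero]
  | tmul m n => rfl
  | add x y hx hy => rw [map_add, hx, hy, map_add, map_add]

/-- The right `B`-module structure `(m ⊗ n) b = m ⊗ n b` on `M ⊗_A N`, for an `A`-`B` bimodule
`N`. -/
def rightAct (ρ : RightAct A M) (lam : LeftAct A N) (σ : RightAct B N)
    (h : ∀ a b n, σ.act b (lam.act a n) = lam.act a (σ.act b n)) :
    RightAct B (BTensor ρ lam) where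
  act := AddMonoidHom.mk' (fun b => lTensor ρ (σ.act b) (fun a n => h a b n))
    (fun b b' => hom_ext fun m n => by simp)
  one_act x := by
    refine DFunLike.congr_fun (?_ : _ = AddMonoidHom.id _) x
    exact hom_ext fun m n => by simp [σ.one_act]
  mul_act b b' x := by
    refine DFunLike.congr_fun (f := lTensor ρ (σ.act (b * b')) (fun a n => h a _ n))
      (g := (lTensor ρ (σ.act b') (fun a n => h a _ n)).comp
        (lTensor ρ (σ.act b) (fun a n => h a _ n))) ?_ x
    exact hom_ext fun m n => by simp [σ.mul_act]

@[simp] theorem rightAct_mk (σ : RightAct B N) (h) (b : B) (m : M) (n : N) :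
    (rightAct ρ lam σ h).act b (mk ρ lam m n) = mk ρ lam m (σ.act b n) := rfl

/-- For an `A`-`B` bimodule `N` and a left `B`-module `P`, the map
`N ⊗_B P → (M ⊗_A N) ⊗_B P`, `y ↦ m ⊗ y`. -/
def tmulLeft (ρ : RightAct A M) (lam : LeftAct A N) (σ : RightAct B N) (mu : LeftAct B P)
    (h : ∀ a b n, σ.act b (lam.act a n) = lam.act a (σ.act b n)) (m : M) :
    BTensor σ mu →+ BTensor (rightAct ρ lam σ h) mu :=
  rTensor mu (mk ρ lam m) (fun b n => (rightAct_mk σ h b m n).symm)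

@[simp] theorem tmulLeft_mk (σ : RightAct B N) (mu : LeftAct B P) (h) (m : M) (n : N) (p : P) :
    tmulLeft ρ lam σ mu h m (mk σ mu n p) = mk _ mu (mk ρ lam m n) p := rfl

/-- For an `A`-`B` bimodule `N`, a left `B`-module `P` and a left `A`-linear map
`g : N' → N ⊗_B P`, the map `M ⊗_A g : M ⊗_A N' → M ⊗_A N ⊗_B P`. -/
def insert (ρ : RightAct A M) (lam : LeftAct A N) (σ : RightAct B N) (mu : LeftAct B P)
    (h : ∀ a b n, σ.act b (lam.act a n) = lam.act a (σ.act b n))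
    (g : N' →+ BTensor σ mu)
    (hg : ∀ a n, g (lam'.act a n) =
      rTensor mu (lam.act a) (fun b n => (h a b n).symm) (g n)) :
    BTensor ρ lam' →+ BTensor (rightAct ρ lam σ h) mu :=
  lift
    (AddMonoidHom.mk' (fun m => (tmulLeft ρ lam σ mu h m).comp g)
      (fun m m' => by
        ext n
        simp only [AddMonoidHom.comp_apply, AddMonoidHom.add_apply]
        induction g n using induction_on with
        | zero => simp only [map_zero, add_zero]
        | tmul x y => simp only [tmulLeft_mk, map_add, AddMonoidHom.add_apply]
        | add x y hx hy => rw [map_add, hx, hy, map_add, map_add]; abel))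
    (fun a m n => by
      simp only [AddMonoidHom.mk'_apply, AddMonoidHom.comp_apply, hg]
      induction g n using induction_on with
      | zero => simp only [map_zero]
      | tmul x y => simp only [tmulLeft_mk, rTensor_mk, mk_balanced]
      | add x y hx hy => rw [map_add, hx, hy, map_add, map_add])

@[simp] theorem insert_mk (σ : RightAct B N) (mu : LeftAct B P) (h) (g : N' →+ BTensor σ mu)
    (hg) (m : M) (n : N') :
    insert (lam' := lam') ρ lam σ mu h g hg (mk ρ lam' m n) = tmulLeft ρ lam σ mu h m (g n) := rfl

theorem tmulLeft_natural {N₁ : Type*} [AddCommGroup N₁] {B₁ B₂ : Type*}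
    [Ring B₁] [Ring B₂] (ρ : RightAct A M) {lam : LeftAct A N}
    {σ₁ : RightAct B₁ N} {mu₁ : LeftAct B₁ N₁} {σ₂ : RightAct B₂ N} {mu₂ : LeftAct B₂ N}
    (h₁ : ∀ a b n, σ₁.act b (lam.act a n) = lam.act a (σ₁.act b n))
    (h₂ : ∀ a b n, σ₂.act b (lam.act a n) = lam.act a (σ₂.act b n))
    (c : ∀ a b n, σ₁.act b (mu₂.act a n) = mu₂.act a (σ₁.act b n))
    (g : N →+ BTensor σ₂ mu₂)
    (hg : ∀ a n, g (lam.act a n) =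
      rTensor mu₂ (lam.act a) (fun b n => (h₂ a b n).symm) (g n))
    (hgσ : ∀ b n, g (σ₁.act b n) = (rightAct σ₂ mu₂ σ₁ c).act b (g n))
    (hi : ∀ b x, insert (lam' := lam) ρ lam σ₂ mu₂ h₂ g hg ((rightAct ρ lam σ₁ h₁).act b x) =
      (rightAct (rightAct ρ lam σ₂ h₂) mu₂ σ₁ c).act b
        (insert (lam' := lam) ρ lam σ₂ mu₂ h₂ g hg x))
    (ht : ∀ m b x, tmulLeft ρ lam σ₂ mu₂ h₂ m ((rightAct σ₂ mu₂ σ₁ c).act b x) =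
      (rightAct (rightAct ρ lam σ₂ h₂) mu₂ σ₁ c).act b (tmulLeft ρ lam σ₂ mu₂ h₂ m x))
    (m : M) (y : BTensor σ₁ mu₁) :
    rTensor mu₁ (insert (lam' := lam) ρ lam σ₂ mu₂ h₂ g hg) hi
        (tmulLeft ρ lam σ₁ mu₁ h₁ m y) =
      rTensor mu₁ (tmulLeft ρ lam σ₂ mu₂ h₂ m) (ht m) (rTensor mu₁ g hgσ y) := by
  induction y using induction_on with
  | zero => simp only [map_zero]
  | tmul a b => simp only [tmulLeft_mk, rTensor_mk, insert_mk]
  | add x y hx hy => simp only [map_add, hx, hy]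

theorem tmulLeft_rightAct {C : Type*} [Ring C] (ρ : RightAct A M) {lam : LeftAct A N}
    {σ : RightAct B N} {mu : LeftAct B P} {τ : RightAct C P}
    (h : ∀ a b n, σ.act b (lam.act a n) = lam.act a (σ.act b n))
    (c : ∀ a b n, τ.act b (mu.act a n) = mu.act a (τ.act b n)) (m : M) (b : C)
    (x : BTensor σ mu) : tmulLeft ρ lam σ mu h m ((rightAct σ mu τ c).act b x) =
      (rightAct (rightAct ρ lam σ h) mu τ c).act b (tmulLeft ρ lam σ mu h m x) := by
  induction x using induction_on with
  | zero => simp only [map_zero]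
  | tmul a b => simp only [tmulLeft_mk, rightAct_mk]
  | add x y hx hy => simp only [map_add, hx, hy]

theorem insert_rightAct {C : Type*} [Ring C] (ρ : RightAct A M) {lam : LeftAct A N}
    {σ : RightAct B N} {mu : LeftAct B P} {τ : RightAct C P} {τ' : RightAct C N'}
    (h : ∀ a b n, σ.act b (lam.act a n) = lam.act a (σ.act b n))
    (c : ∀ a b n, τ.act b (mu.act a n) = mu.act a (τ.act b n))
    (c' : ∀ a b n, τ'.act b (lam'.act a n) = lam'.act a (τ'.act b n))
    (g : N' →+ BTensor σ mu)
    (hg : ∀ a n, g (lam'.act a n) = rTensor mu (lam.act a) (fun b n => (h a b n).symm) (g n))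
    (hgτ : ∀ b n, g (τ'.act b n) = (rightAct σ mu τ c).act b (g n))
    (b : C) (x : BTensor ρ lam') :
    insert (lam' := lam') ρ lam σ mu h g hg ((rightAct ρ lam' τ' c').act b x) =
      (rightAct (rightAct ρ lam σ h) mu τ c).act b (insert ρ lam σ mu h g hg x) := by
  induction x using induction_on with
  | zero => simp only [map_zero]
  | tmul m n => rw [rightAct_mk, insert_mk, insert_mk, hgτ, tmulLeft_rightAct]
  | add x y hx hy => simp only [map_add, hx, hy]

theorem insert_tmulLeft {B₁ B₂ N₁ N₂ N₃ : Type*} [Ring B₁] [Ring B₂] [AddCommGroup N₁]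
    [AddCommGroup N₂] [AddCommGroup N₃]
    (ρ : RightAct A M) {lam : LeftAct A N} {σ₂ : RightAct B₂ N} {mu₂ : LeftAct B₂ N₁}
    {σ₁ : RightAct B₁ N₁} {mu₁ : LeftAct B₁ N₂} {mu₃ : LeftAct B₂ N₃}
    (h₂ : ∀ a b n, σ₂.act b (lam.act a n) = lam.act a (σ₂.act b n))
    (c : ∀ a b n, σ₁.act b (mu₂.act a n) = mu₂.act a (σ₁.act b n))
    (g : N₃ →+ BTensor σ₁ mu₁)
    (hg : ∀ a n, g (mu₃.act a n) = rTensor mu₁ (mu₂.act a) (fun b n => (c a b n).symm) (g n))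
    (m : M) (y : BTensor σ₂ mu₃) :
    insert (rightAct ρ lam σ₂ h₂) mu₂ σ₁ mu₁ c g hg (tmulLeft ρ lam σ₂ mu₃ h₂ m y) =
      rTensor mu₁ (tmulLeft ρ lam σ₂ mu₂ h₂ m) (tmulLeft_rightAct ρ h₂ c m)
        (insert σ₂ mu₂ σ₁ mu₁ c g hg y) := by
  induction y using induction_on with
  | zero => simp only [map_zero]
  | tmul a b =>
    rw [tmulLeft_mk, insert_mk, insert_mk]
    induction g b using induction_on with
    | zero => simp only [map_zero]
    | tmul x y => simp only [tmulLeft_mk, rTensor_mk]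
    | add x y hx hy => simp only [map_add, hx, hy]
  | add x y hx hy => simp only [map_add, hx, hy]

/-- If `(g₂ ⊗ N) ∘ g₁ = (N ⊗ g₁) ∘ g₂`, then the same holds for `M ⊗ g₁` and `M ⊗ g₂`. -/
theorem insert_coassoc {B₁ B₂ : Type*} [Ring B₁] [Ring B₂] (ρ : RightAct A M)
    {lam : LeftAct A N} {σ₁ : RightAct B₁ N} {mu₁ : LeftAct B₁ N}
    {σ₂ : RightAct B₂ N} {mu₂ : LeftAct B₂ N}
    (h₁ : ∀ a b n, σ₁.act b (lam.act a n) = lam.act a (σ₁.act b n))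
    (h₂ : ∀ a b n, σ₂.act b (lam.act a n) = lam.act a (σ₂.act b n))
    (c : ∀ a b n, σ₁.act b (mu₂.act a n) = mu₂.act a (σ₁.act b n))
    (g₁ : N →+ BTensor σ₁ mu₁) (g₂ : N →+ BTensor σ₂ mu₂)
    (hg₁ : ∀ a n, g₁ (lam.act a n) =
      rTensor mu₁ (lam.act a) (fun b n => (h₁ a b n).symm) (g₁ n))
    (hg₁' : ∀ a n, g₁ (mu₂.act a n) =
      rTensor mu₁ (mu₂.act a) (fun b n => (c a b n).symm) (g₁ n))
    (hg₂ : ∀ a n, g₂ (lam.act a n) =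
      rTensor mu₂ (lam.act a) (fun b n => (h₂ a b n).symm) (g₂ n))
    (hgσ : ∀ b n, g₂ (σ₁.act b n) = (rightAct σ₂ mu₂ σ₁ c).act b (g₂ n))
    (H : ∀ n, rTensor mu₁ g₂ hgσ (g₁ n) = insert σ₂ mu₂ σ₁ mu₁ c g₁ hg₁' (g₂ n))
    (x : BTensor ρ lam) :
    rTensor mu₁ (insert ρ lam σ₂ mu₂ h₂ g₂ hg₂) (insert_rightAct ρ h₂ c h₁ g₂ hg₂ hgσ)
        (insert ρ lam σ₁ mu₁ h₁ g₁ hg₁ x) =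
      insert (rightAct ρ lam σ₂ h₂) mu₂ σ₁ mu₁ c g₁ hg₁' (insert ρ lam σ₂ mu₂ h₂ g₂ hg₂ x) := by
  induction x using induction_on with
  | zero => simp only [map_zero]
  | tmul m n =>
    rw [insert_mk, insert_mk, insert_tmulLeft, ← H,
      tmulLeft_natural ρ h₁ h₂ c g₂ hg₂ hgσ _ (tmulLeft_rightAct ρ h₂ c)]
  | add x y hx hy => simp only [map_add, hx, hy]

/-- `M ⊗_A e` for a left `A`-linear map `e : N → A`, followed by `M ⊗_A A ≅ M`. -/
def contractRight (ρ : RightAct A M) (e : N →+ A) (he : ∀ a n, e (lam.act a n) = a * e n) :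
    BTensor ρ lam →+ M :=
  lift (ρ.act.flip.compl₂ e) (fun a m n => by simp [he, ρ.mul_act])

@[simp] theorem contractRight_mk (e : N →+ A) (he) (m : M) (n : N) :
    contractRight (lam := lam) ρ e he (mk ρ lam m n) = ρ.act (e n) m := rfl

theorem insert_counit {C : Type*} [Ring C] {M N : Type*} [AddCommGroup M] [AddCommGroup N]
    (ρ : RightAct C M) {lam : LeftAct C N} {σ : RightAct A N} {mu : LeftAct A P}
    (h : ∀ a b n, σ.act b (lam.act a n) = lam.act a (σ.act b n)) (g : N →+ BTensor σ mu)
    (hg : ∀ a n, g (lam.act a n) = rTensor mu (lam.act a) (fun b n => (h a b n).symm) (g n))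
    (e : P →+ A) (he : ∀ a n, e (mu.act a n) = a * e n)
    (H : ∀ n, contractRight σ e he (g n) = n) (x : BTensor ρ lam) :
    contractRight (rightAct ρ lam σ h) e he (insert ρ lam σ mu h g hg x) = x := by
  induction x using induction_on with
  | zero => simp only [map_zero]
  | tmul m n =>
    rw [insert_mk]
    nth_rewrite 2 [← H n]
    induction g n using induction_on with
    | zero => simp only [map_zero]
    | tmul x y => simp only [tmulLeft_mk, contractRight_mk, rightAct_mk]
    | add x y hx hy => simp only [map_add, hx, hy]
  | add x y hx hy => simp only [map_add, hx, hy]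

/-- `e ⊗_A N` for a right `A`-linear map `e : M → A`, followed by `A ⊗_A N ≅ N`. -/
def contractLeft (lam : LeftAct A N) (e : M →+ A)
    (he : ∀ a m, e (ρ.act a m) = e m * a) : BTensor ρ lam →+ N :=
  lift (lam.act.comp e) (fun a m n => by simp [he, lam.mul_act])

@[simp] theorem contractLeft_mk (e : M →+ A) (he) (m : M) (n : N) :
    contractLeft (ρ := ρ) lam e he (mk ρ lam m n) = lam.act (e m) n := rfl

/-- The map `m ⊗ n ↦ f m * g n` with values in a ring. -/
def mulMap {Q : Type*} [Ring Q] (f : M →+ Q) (g : N →+ Q)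
    (h : ∀ a m n, f (ρ.act a m) * g n = f m * g (lam.act a n)) : BTensor ρ lam →+ Q :=
  lift ((AddMonoidHom.mul.comp f).compl₂ g) h

@[simp] theorem mulMap_mk {Q : Type*} [Ring Q] (f : M →+ Q) (g : N →+ Q) (h) (m : M) (n : N) :
    mulMap (ρ := ρ) (lam := lam) f g h (mk ρ lam m n) = f m * g n := rfl

/-- For biadditive maps `F`, `G` and a fixed tensor `z = ∑ mᵢ ⊗ nᵢ`, the map
`p ⊗ q ↦ ∑ F p mᵢ ⊗ G q nᵢ`, provided that it is balanced. -/
def prod {P Q M M' N N' : Type*} [AddCommGroup P] [AddCommGroup Q]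
    [AddCommGroup M] [AddCommGroup M'] [AddCommGroup N] [AddCommGroup N']
    {ρ : RightAct A M} {lam : LeftAct A N} {ρ' : RightAct A M'} {lam' : LeftAct A N'}
    {σ : RightAct B P} {mu : LeftAct B Q}
    (F : P →+ M →+ M') (G : Q →+ N →+ N')
    (hF : ∀ p a m, F p (ρ.act a m) = ρ'.act a (F p m))
    (hG : ∀ q a n, G q (lam.act a n) = lam'.act a (G q n))
    (z : BTensor ρ lam)
    (hz : ∀ b p q, (map (F (σ.act b p)) (G q) (hF _) (hG _) z : BTensor ρ' lam') =
      map (F p) (G (mu.act b q)) (hF _) (hG _) z) :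
    BTensor σ mu →+ BTensor ρ' lam' :=
  lift (AddMonoidHom.mk' (fun p => AddMonoidHom.mk'
        (fun q => map (F p) (G q) (hF p) (hG q) z)
        (fun q q' => by
          clear hz
          induction z using induction_on with
          | zero => simp only [map_zero, add_zero]
          | tmul x y => simp only [map_mk, map_add, AddMonoidHom.add_apply]
          | add x y hx hy => rw [map_add, hx, hy, map_add, map_add]; abel))
      (fun p p' => by
        ext q
        simp only [AddMonoidHom.mk'_apply, AddMonoidHom.add_apply]
        clear hz
        induction z using induction_on with
        | zero => simp only [map_zero, add_zero]
        | tmul x y => simp only [map_mk, map_add, AddMonoidHom.add_apply]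
        | add x y hx hy => rw [map_add, hx, hy, map_add, map_add]; abel))
    hz

@[simp] theorem prod_mk {P Q M M' N N' : Type*} [AddCommGroup P] [AddCommGroup Q]
    [AddCommGroup M] [AddCommGroup M'] [AddCommGroup N] [AddCommGroup N']
    {ρ : RightAct A M} {lam : LeftAct A N} {ρ' : RightAct A M'} {lam' : LeftAct A N'}
    {σ : RightAct B P} {mu : LeftAct B Q}
    (F : P →+ M →+ M') (G : Q →+ N →+ N') (hF) (hG) (z : BTensor ρ lam) (hz) (p : P) (q : Q) :
    prod (ρ' := ρ') (lam' := lam') F G hF hG z hz (mk σ mu p q) =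
      map (F p) (G q) (hF p) (hG q) z := rfl

end BTensor

theorem BTensor.rTensor_rightAct {A B M M' N : Type*} [Ring A] [Ring B]
    [AddCommGroup M] [AddCommGroup M'] [AddCommGroup N]
    {ρ : RightAct A M} {ρ' : RightAct A M'} {lam : LeftAct A N} {σ : RightAct B N}
    (f : M →+ M') (hf : ∀ a m, f (ρ.act a m) = ρ'.act a (f m))
    (h : ∀ a b n, σ.act b (lam.act a n) = lam.act a (σ.act b n)) (b : B) (x : BTensor ρ lam) :
    BTensor.rTensor (ρ' := ρ') lam f hf ((BTensor.rightAct ρ lam σ h).act b x) =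
      (BTensor.rightAct ρ' lam σ h).act b (BTensor.rTensor (ρ' := ρ') lam f hf x) := by
  induction x using BTensor.induction_on with
  | zero => simp only [map_zero]
  | tmul m n => rfl
  | add x y hx hy => simp only [map_add, hx, hy]

theorem BTensor.rightAct_comm {A B C M N : Type*} [Ring A] [Ring B] [Ring C]
    [AddCommGroup M] [AddCommGroup N]
    {ρ : RightAct A M} {lam : LeftAct A N} {σ : RightAct B N} {τ : RightAct C N}
    (h : ∀ a b n, σ.act b (lam.act a n) = lam.act a (σ.act b n))
    (h' : ∀ a c n, τ.act c (lam.act a n) = lam.act a (τ.act c n))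
    (H : ∀ c b n, τ.act c (σ.act b n) = σ.act b (τ.act c n)) (c : C) (b : B)
    (x : BTensor ρ lam) :
    (BTensor.rightAct ρ lam τ h').act c ((BTensor.rightAct ρ lam σ h).act b x) =
      (BTensor.rightAct ρ lam σ h).act b ((BTensor.rightAct ρ lam τ h').act c x) := by
  induction x using BTensor.induction_on with
  | zero => simp only [map_zero]
  | tmul m n => simp only [BTensor.rightAct_mk, H]
  | add x y hx hy => simp only [map_add, hx, hy]

theorem BTensor.insert_rTensor {A B M M' N N' P : Type*} [Ring A] [Ring B]
    [AddCommGroup M] [AddCommGroup M'] [AddCommGroup N] [AddCommGroup N'] [AddCommGroup P]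
    {ρ : RightAct A M} {ρ' : RightAct A M'} {lam : LeftAct A N} {lam' : LeftAct A N'}
    {σ : RightAct B N} {mu : LeftAct B P}
    (f : M →+ M') (hf : ∀ a m, f (ρ.act a m) = ρ'.act a (f m))
    (h : ∀ a b n, σ.act b (lam.act a n) = lam.act a (σ.act b n))
    (g : N' →+ BTensor σ mu)
    (hg : ∀ a n, g (lam'.act a n) =
      BTensor.rTensor mu (lam.act a) (fun b n => (h a b n).symm) (g n))
    (hh : ∀ b x, BTensor.rTensor (ρ' := ρ') lam f hf ((BTensor.rightAct ρ lam σ h).act b x) =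
      (BTensor.rightAct ρ' lam σ h).act b (BTensor.rTensor (ρ' := ρ') lam f hf x))
    (x : BTensor ρ lam') :
    BTensor.insert ρ' lam σ mu h g hg (BTensor.rTensor (ρ' := ρ') lam' f hf x) =
      BTensor.rTensor (ρ' := BTensor.rightAct ρ' lam σ h) mu
        (BTensor.rTensor (ρ' := ρ') lam f hf) hh (BTensor.insert ρ lam σ mu h g hg x) := by
  induction x using BTensor.induction_on with
  | zero => simp only [map_zero]
  | tmul m n =>
    rw [BTensor.rTensor_mk, BTensor.insert_mk, BTensor.insert_mk]
    induction g n using BTensor.induction_on with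
    | zero => simp only [map_zero]
    | tmul x y => simp only [BTensor.tmulLeft_mk, BTensor.rTensor_mk]
    | add x y hx hy => simp only [map_add, hx, hy]
  | add x y hx hy => simp only [map_add, hx, hy]

end BTensor

/-! ### Corings and comodules -/

/-- An `A`-coring structure on the `A`-`A` bimodule `C`. -/
structure Coring {A C : Type*} [Ring A] [AddCommGroup C] (lact : LeftAct A C)
    (ract : RightAct A C) where
  act_comm : ∀ a b c, ract.act b (lact.act a c) = lact.act a (ract.act b c)
  comul : C →+ BTensor ract lact
  comul_lact : ∀ a c, comul (lact.act a c) =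
    BTensor.rTensor lact (lact.act a) (fun b n => (act_comm a b n).symm) (comul c)
  comul_ract : ∀ b c, comul (ract.act b c) =
    (BTensor.rightAct ract lact ract act_comm).act b (comul c)
  counit : C →+ A
  counit_lact : ∀ a c, counit (lact.act a c) = a * counit c
  counit_ract : ∀ b c, counit (ract.act b c) = counit c * b
  coassoc : ∀ c, BTensor.rTensor lact comul comul_ract (comul c) =
    BTensor.insert ract lact ract lact act_comm comul comul_lact (comul c)
  counit_left : ∀ c, BTensor.contractLeft lact counit counit_ract (comul c) = c
  counit_right : ∀ c, BTensor.contractRight ract counit counit_lact (comul c) = c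

/-- The structure of a right `C`-comodule on the right `A`-module `M`, for an `A`-coring `C`. -/
structure Coaction {A C M : Type*} [Ring A] [AddCommGroup C] [AddCommGroup M]
    {lact : LeftAct A C} {ract : RightAct A C} (𝒞 : Coring lact ract) (ρ : RightAct A M) where
  coact : M →+ BTensor ρ lact
  coact_act : ∀ a m, coact (ρ.act a m) =
    (BTensor.rightAct ρ lact ract 𝒞.act_comm).act a (coact m)
  coassoc : ∀ m, BTensor.rTensor lact coact coact_act (coact m) =
    BTensor.insert ρ lact ract lact 𝒞.act_comm 𝒞.comul 𝒞.comul_lact (coact m)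
  counit : ∀ m, BTensor.contractRight ρ 𝒞.counit 𝒞.counit_lact (coact m) = m

/-! ### Module structures given by left and right multiplication -/

section Actions

variable {A H : Type*} [Ring A] [Ring H]

/-- `a h = s(a) * h`. -/
def LeftAct.mulLeft (s : A →+* H) : LeftAct A H where
  act := AddMonoidHom.mul.comp s.toAddMonoidHom
  one_act m := by simp
  mul_act a b m := by simp [mul_assoc]

/-- `a h = h * t(a)`. -/
def LeftAct.mulRight (t : Aᵐᵒᵖ →+* H) : LeftAct A H where
  act := AddMonoidHom.mul.flip.comp (t.toAddMonoidHom.comp opAddEquiv.toAddMonoidHom)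
  one_act m := by simp
  mul_act a b m := by simp [mul_assoc]

/-- `h a = h * s(a)`. -/
def RightAct.mulRight (s : A →+* H) : RightAct A H where
  act := AddMonoidHom.mul.flip.comp s.toAddMonoidHom
  one_act m := by simp
  mul_act a b m := by simp [mul_assoc]

/-- `h a = t(a) * h`. -/
def RightAct.mulLeft (t : Aᵐᵒᵖ →+* H) : RightAct A H where
  act := AddMonoidHom.mul.comp (t.toAddMonoidHom.comp opAddEquiv.toAddMonoidHom)
  one_act m := by simp
  mul_act a b m := by simp [mul_assoc]

/-- The right module structure underlying a module over the opposite ring. -/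
def RightAct.ofModule (A M : Type*) [Ring A] [AddCommGroup M] [Module Aᵐᵒᵖ M] :
    RightAct A M where
  act := (smulAddHom Aᵐᵒᵖ M).comp opAddEquiv.toAddMonoidHom
  one_act m := by simp
  mul_act a b m := by simp [mul_smul]

@[simp] theorem LeftAct.mulLeft_act (s : A →+* H) (a : A) (h : H) :
    (LeftAct.mulLeft s).act a h = s a * h := rfl

@[simp] theorem LeftAct.mulRight_act (t : Aᵐᵒᵖ →+* H) (a : A) (h : H) :
    (LeftAct.mulRight t).act a h = h * t (op a) := rfl

@[simp] theorem RightAct.mulRight_act (s : A →+* H) (a : A) (h : H) :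
    (RightAct.mulRight s).act a h = h * s a := rfl

@[simp] theorem RightAct.mulLeft_act (t : Aᵐᵒᵖ →+* H) (a : A) (h : H) :
    (RightAct.mulLeft t).act a h = t (op a) * h := rfl

@[simp] theorem RightAct.ofModule_act (M : Type*) [AddCommGroup M] [Module Aᵐᵒᵖ M] (a : A)
    (m : M) : (RightAct.ofModule A M).act a m = op a • m := rfl

theorem LeftAct.mulRight_mulLeft (s : A →+* H) (x : H) (a : A) (h : H) :
    AddMonoidHom.mulRight x ((LeftAct.mulLeft s).act a h) =
      (LeftAct.mulLeft s).act a (AddMonoidHom.mulRight x h) := mul_assoc _ _ _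

theorem LeftAct.mulLeft_mulRight (t : Aᵐᵒᵖ →+* H) (x : H) (a : A) (h : H) :
    AddMonoidHom.mulLeft x ((LeftAct.mulRight t).act a h) =
      (LeftAct.mulRight t).act a (AddMonoidHom.mulLeft x h) := (mul_assoc _ _ _).symm

theorem RightAct.mulRight_mulLeft (t : Aᵐᵒᵖ →+* H) (x : H) (a : A) (h : H) :
    AddMonoidHom.mulRight x ((RightAct.mulLeft t).act a h) =
      (RightAct.mulLeft t).act a (AddMonoidHom.mulRight x h) := mul_assoc _ _ _

theorem RightAct.mulLeft_mulRight {u : A → H} {ρ : RightAct A H}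
    (hρ : ∀ r a, ρ.act r a = a * u r) (x : H) (r : A) (h : H) :
    AddMonoidHom.mulLeft x (ρ.act r h) = ρ.act r (AddMonoidHom.mulLeft x h) := by
  simp [hρ, mul_assoc]

theorem RightAct.flip_mulRight {K M : Type*} [Ring K] [AddCommGroup M] {u : K → A}
    {ρ : RightAct K A} (hρ : ∀ r a, ρ.act r a = a * u r) {ρM : RightAct K M} {act : RightAct A M}
    (hρM : ∀ r m, ρM.act r m = act.act (u r) m) (m : M) (r : K) (a : A) :
    act.act.flip m (ρ.act r a) = ρM.act r (act.act.flip m a) := by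
  simp [hρ, hρM, act.mul_act]

theorem RightAct.regular_mulLeft (t : Aᵐᵒᵖ →+* H) (h : H) (l : A) (m : H) :
    (RightAct.mulRight (RingHom.id H)).act h ((RightAct.mulLeft t).act l m) =
      (RightAct.mulLeft t).act l ((RightAct.mulRight (RingHom.id H)).act h m) := mul_assoc _ _ _

end Actions

/-! ### Factorwise products -/

section Takeuchi

variable {A H K M N : Type*} [Ring A] [Ring H] [Ring K] [AddCommGroup M] [AddCommGroup N]

/-- For `y = ∑ aᵢ ⊗ hᵢ` in `A ⊗_K H` with `∑ u(r) aᵢ ⊗ hᵢ = ∑ aᵢ ⊗ t(r) hᵢ` for all `r`, and a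
right `A`-module `M` with `m r = m u(r)`, the map `m ⊗ h ↦ ∑ m aᵢ ⊗ h hᵢ` on `M ⊗_K H`. Here
`r h = h t(r)` on `H` and `a r = a u(r)` on `A`. -/
def takeuchiMulRight (u : K → A) (t : Kᵐᵒᵖ →+* H) {ρA : RightAct K A}
    (hρA : ∀ r a, ρA.act r a = a * u r) {ρM : RightAct K M} (act : RightAct A M)
    (hρM : ∀ r m, ρM.act r m = act.act (u r) m) (y : BTensor ρA (LeftAct.mulRight t))
    (hy : ∀ r, BTensor.rTensor (ρ' := ρA) (LeftAct.mulRight t) (AddMonoidHom.mulLeft (u r))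
        (RightAct.mulLeft_mulRight hρA _) y =
      BTensor.lTensor ρA (AddMonoidHom.mulLeft (t (op r))) (LeftAct.mulLeft_mulRight t _) y) :
    BTensor ρM (LeftAct.mulRight t) →+ BTensor ρM (LeftAct.mulRight t) :=
  BTensor.prod act.act.flip AddMonoidHom.mul
    (RightAct.flip_mulRight hρA hρM) (LeftAct.mulLeft_mulRight t) y
    (fun r m h => by
      have := congrArg (BTensor.map (ρ' := ρM) (lam' := LeftAct.mulRight t) (act.act.flip m)
        (AddMonoidHom.mulLeft h) (RightAct.flip_mulRight hρA hρM m)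
        (LeftAct.mulLeft_mulRight t h)) (hy r)
      convert this using 1
      · clear this hy
        induction y using BTensor.induction_on with
        | zero => simp only [map_zero]
        | tmul a h' => simp [hρM, act.mul_act]
        | add x y hx hy => simp only [map_add, hx, hy]
      · clear this hy
        induction y using BTensor.induction_on with
        | zero => simp only [map_zero]
        | tmul a h' => exact congrArg (BTensor.mk _ _ (act.act a m)) (mul_assoc h (t (op r)) h')
        | add x y hx hy => simp only [map_add, hx, hy])

/-- For `x = ∑ mᵢ ⊗ hᵢ` in `M ⊗_K H` with `∑ mᵢ u(l) ⊗ hᵢ = ∑ mᵢ ⊗ hᵢ s(l)` for all `l`, the map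
`a ⊗ h ↦ ∑ mᵢ a ⊗ hᵢ h` from `A ⊗_K H` to `M ⊗_K H`. Here `l h = s(l) h` on `H` and
`a l = u(l) a` on `A`. -/
def takeuchiMulLeft (u : K → A) (s : K →+* H) {ρA : RightAct K A}
    (hρA : ∀ l a, ρA.act l a = u l * a) {ρM : RightAct K M} (act : RightAct A M)
    (hρM : ∀ a l m, act.act a (ρM.act l m) = ρM.act l (act.act a m))
    (x : BTensor ρM (LeftAct.mulLeft s))
    (hx : ∀ l, BTensor.rTensor (ρ' := ρM) (LeftAct.mulLeft s) (act.act (u l))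
        (hρM _) x =
      BTensor.lTensor ρM (AddMonoidHom.mulRight (s l)) (LeftAct.mulRight_mulLeft s _) x) :
    BTensor ρA (LeftAct.mulLeft s) →+ BTensor ρM (LeftAct.mulLeft s) :=
  BTensor.prod act.act AddMonoidHom.mul.flip
    hρM (LeftAct.mulRight_mulLeft s) x
    (fun l a h => by
      have := congrArg (BTensor.map (ρ' := ρM) (lam' := LeftAct.mulLeft s) (act.act a)
        (AddMonoidHom.mulRight h) (hρM a)
        (LeftAct.mulRight_mulLeft s h)) (hx l)
      convert this using 1
      · clear this hx
        induction x using BTensor.induction_on with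
        | zero => simp only [map_zero]
        | tmul a h' => simp [hρA, act.mul_act]
        | add x y hx hy => simp only [map_add, hx, hy]
      · clear this hx
        induction x using BTensor.induction_on with
        | zero => simp only [map_zero]
        | tmul m h' =>
          exact congrArg (BTensor.mk _ _ (act.act a m)) (mul_assoc h' (s l) h).symm
        | add x y hx hy => simp only [map_add, hx, hy])

@[simp] theorem takeuchiMulRight_mk (u : K → A) (t : Kᵐᵒᵖ →+* H) {ρA : RightAct K A}
    (hρA) {ρM : RightAct K M} (act : RightAct A M) (hρM)
    (y : BTensor ρA (LeftAct.mulRight t)) (hy) (m : M) (h : H) :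
    takeuchiMulRight u t hρA act hρM y hy (BTensor.mk ρM _ m h) =
      BTensor.map (act.act.flip m) (AddMonoidHom.mulLeft h)
        (RightAct.flip_mulRight hρA hρM m) (LeftAct.mulLeft_mulRight t h) y := rfl

@[simp] theorem takeuchiMulLeft_mk (u : K → A) (s : K →+* H) {ρA : RightAct K A}
    (hρA) {ρM : RightAct K M} (act : RightAct A M) (hρM)
    (x : BTensor ρM (LeftAct.mulLeft s)) (hx) (a : A) (h : H) :
    takeuchiMulLeft u s hρA act hρM x hx (BTensor.mk ρA _ a h) =
      BTensor.map (act.act a) (AddMonoidHom.mulRight h)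
        (hρM a) (LeftAct.mulRight_mulLeft s h) x := rfl

theorem takeuchiMulRight_natural (u : K → A) (t : Kᵐᵒᵖ →+* H) {ρA : RightAct K A}
    (hρA : ∀ r a, ρA.act r a = a * u r) {ρM : RightAct K M} {ρN : RightAct K N}
    (act : RightAct A M) (act' : RightAct A N)
    (hρM : ∀ r m, ρM.act r m = act.act (u r) m) (hρN : ∀ r m, ρN.act r m = act'.act (u r) m)
    (f : N →+ M) (hf : ∀ a n, f (ρN.act a n) = ρM.act a (f n))
    (hfA : ∀ a n, f (act'.act a n) = act.act a (f n))
    (y : BTensor ρA (LeftAct.mulRight t)) (hy) (x : BTensor ρN (LeftAct.mulRight t)) :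
    BTensor.rTensor (ρ' := ρM) _ f hf (takeuchiMulRight u t hρA act' hρN y hy x) =
      takeuchiMulRight u t hρA act hρM y hy (BTensor.rTensor (ρ' := ρM) _ f hf x) := by
  induction x using BTensor.induction_on with
  | zero => simp only [map_zero]
  | tmul n h =>
    rw [BTensor.rTensor_mk, takeuchiMulRight_mk, takeuchiMulRight_mk]
    clear hy
    induction y using BTensor.induction_on with
    | zero => simp only [map_zero]
    | tmul a b =>
      simp only [BTensor.map_mk, BTensor.rTensor_mk, AddMonoidHom.flip_apply, hfA]
    | add x y hx hy => simp only [map_add, hx, hy]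
  | add x y hx hy => simp only [map_add, hx, hy]

theorem takeuchiMulLeft_natural (u : K → A) (s : K →+* H) {ρA : RightAct K A}
    (hρA : ∀ l a, ρA.act l a = u l * a) {ρM : RightAct K M} {ρN : RightAct K N}
    (act : RightAct A M) (act' : RightAct A N)
    (hρM : ∀ a l m, act.act a (ρM.act l m) = ρM.act l (act.act a m))
    (hρN : ∀ a l m, act'.act a (ρN.act l m) = ρN.act l (act'.act a m))
    (f : N →+ M) (hf : ∀ a n, f (ρN.act a n) = ρM.act a (f n))
    (hfA : ∀ a n, f (act'.act a n) = act.act a (f n))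
    (x : BTensor ρN (LeftAct.mulLeft s)) (hx)
    (z : BTensor ρM (LeftAct.mulLeft s)) (hz) (e : z = BTensor.rTensor (ρ' := ρM) _ f hf x)
    (y : BTensor ρA (LeftAct.mulLeft s)) :
    BTensor.rTensor (ρ' := ρM) _ f hf (takeuchiMulLeft u s hρA act' hρN x hx y) =
      takeuchiMulLeft u s hρA act hρM z hz y := by
  subst e
  induction y using BTensor.induction_on with
  | zero => simp only [map_zero]
  | tmul a h =>
    rw [takeuchiMulLeft_mk, takeuchiMulLeft_mk]
    clear hx hz
    induction x using BTensor.induction_on with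
    | zero => simp only [map_zero]
    | tmul n b =>
      simp only [BTensor.map_mk, BTensor.rTensor_mk, hfA]
    | add x y hx hy => simp only [map_add, hx, hy]
  | add x y hx hy => simp only [map_add, hx, hy]

theorem takeuchiMulLeft_add (u : K → A) (s : K →+* H) {ρA : RightAct K A}
    (hρA : ∀ l a, ρA.act l a = u l * a) {ρM : RightAct K M} (act : RightAct A M)
    (hρM : ∀ a l m, act.act a (ρM.act l m) = ρM.act l (act.act a m))
    (x x' z : BTensor ρM (LeftAct.mulLeft s)) (hx) (hx') (hz) (e : z = x + x')
    (y : BTensor ρA (LeftAct.mulLeft s)) :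
    takeuchiMulLeft u s hρA act hρM z hz y =
      takeuchiMulLeft u s hρA act hρM x hx y + takeuchiMulLeft u s hρA act hρM x' hx' y := by
  subst e
  induction y using BTensor.induction_on with
  | zero => simp only [map_zero, add_zero]
  | tmul a h => simp only [takeuchiMulLeft_mk, map_add]
  | add x y hx hy => rw [map_add, hx, hy, map_add, map_add]; abel

theorem takeuchiMulLeft_zero (u : K → A) (s : K →+* H) {ρA : RightAct K A}
    (hρA : ∀ l a, ρA.act l a = u l * a) {ρM : RightAct K M} (act : RightAct A M)
    (hρM : ∀ a l m, act.act a (ρM.act l m) = ρM.act l (act.act a m))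
    (z : BTensor ρM (LeftAct.mulLeft s)) (hz) (e : z = 0)
    (y : BTensor ρA (LeftAct.mulLeft s)) :
    takeuchiMulLeft u s hρA act hρM z hz y = 0 := by
  subst e
  induction y using BTensor.induction_on with
  | zero => simp only [map_zero]
  | tmul a h => simp only [takeuchiMulLeft_mk, map_zero]
  | add x y hx hy => rw [map_add, hx, hy, add_zero]

end Takeuchi

/-! ### Bialgebroids -/

theorem RightAct.mulRight_regular {K H : Type*} [Ring K] [Ring H] (s : K →+* H) (r : K) (m : H) :
    (RightAct.mulRight s).act r m = (RightAct.mulRight (RingHom.id H)).act (s r) m := rfl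

theorem takeuchi_right {k R H : Type*} [CommRing k] [Ring R] [Algebra k R] [Ring H]
    [Algebra k H] {s : R →ₐ[k] H} {t : Rᵐᵒᵖ →ₐ[k] H}
    {y : BTensor (RightAct.mulRight (s : R →+* H)) (LeftAct.mulRight (t : Rᵐᵒᵖ →+* H))}
    (hy : ∀ r, BTensor.rTensor (ρ' := RightAct.mulRight (s : R →+* H))
        (LeftAct.mulRight (t : Rᵐᵒᵖ →+* H)) (AddMonoidHom.mulLeft (s r))
        (RightAct.mulLeft_mulRight (RightAct.mulRight_act _) _) y =
      BTensor.lTensor (RightAct.mulRight (s : R →+* H)) (AddMonoidHom.mulLeft (t (op r)))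
        (LeftAct.mulLeft_mulRight _ _) y) (r : R) :
    BTensor.rTensor (ρ' := RightAct.mulRight (s : R →+* H))
        (LeftAct.mulRight (t : Rᵐᵒᵖ →+* H)) (AddMonoidHom.mulLeft ((s : R →+* H) r))
        (RightAct.mulLeft_mulRight (RightAct.mulRight_act _) _) y =
      BTensor.lTensor (RightAct.mulRight (s : R →+* H))
        (AddMonoidHom.mulLeft ((t : Rᵐᵒᵖ →+* H) (op r))) (LeftAct.mulLeft_mulRight _ _) y := hy r

theorem takeuchi_left {k L H : Type*} [CommRing k] [Ring L] [Algebra k L] [Ring H]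
    [Algebra k H] {s : L →ₐ[k] H} {t : Lᵐᵒᵖ →ₐ[k] H}
    {x : BTensor (RightAct.mulLeft (t : Lᵐᵒᵖ →+* H)) (LeftAct.mulLeft (s : L →+* H))}
    (hx : ∀ l, BTensor.rTensor (ρ' := RightAct.mulLeft (t : Lᵐᵒᵖ →+* H))
        (LeftAct.mulLeft (s : L →+* H)) (AddMonoidHom.mulRight (t (op l)))
        (RightAct.mulRight_mulLeft _ _) x =
      BTensor.lTensor (RightAct.mulLeft (t : Lᵐᵒᵖ →+* H)) (AddMonoidHom.mulRight (s l))
        (LeftAct.mulRight_mulLeft _ _) x) (l : L) :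
    BTensor.rTensor (ρ' := RightAct.mulLeft (t : Lᵐᵒᵖ →+* H)) (LeftAct.mulLeft (s : L →+* H))
        ((RightAct.mulRight (RingHom.id H)).act ((t : Lᵐᵒᵖ →+* H) (op l)))
        (RightAct.regular_mulLeft _ _) x =
      BTensor.lTensor (RightAct.mulLeft (t : Lᵐᵒᵖ →+* H))
        (AddMonoidHom.mulRight ((s : L →+* H) l)) (LeftAct.mulRight_mulLeft _ _) x := hx l

/-- A right bialgebroid over `R` with total algebra `H`; the bimodule structure of `H` is
`r h r' = h s(r') t(r)`. -/
structure RightBialgebroid (k R H : Type*) [CommRing k] [Ring R] [Algebra k R] [Ring H]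
    [Algebra k H] where
  /-- the source map -/
  s : R →ₐ[k] H
  /-- the target map -/
  t : Rᵐᵒᵖ →ₐ[k] H
  s_t_comm : ∀ r r', s r * t r' = t r' * s r
  coring : Coring (LeftAct.mulRight (t : Rᵐᵒᵖ →+* H)) (RightAct.mulRight (s : R →+* H))
  /-- the coproduct has its range in the Takeuchi product -/
  takeuchi : ∀ r h,
    BTensor.rTensor (ρ' := RightAct.mulRight (s : R →+* H)) (LeftAct.mulRight (t : Rᵐᵒᵖ →+* H))
      (AddMonoidHom.mulLeft (s r)) (RightAct.mulLeft_mulRight (RightAct.mulRight_act _) _) (coring.comul h) =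
    BTensor.lTensor (RightAct.mulRight (s : R →+* H)) (AddMonoidHom.mulLeft (t (op r)))
      (LeftAct.mulLeft_mulRight _ _) (coring.comul h)
  comul_unit : ∀ r r', coring.comul (s r * t (op r')) = BTensor.mk _ _ (t (op r')) (s r)
  comul_mul : ∀ h h', coring.comul (h * h') =
    takeuchiMulRight (s : R →+* H) (t : Rᵐᵒᵖ →+* H) (RightAct.mulRight_act _)
      (RightAct.mulRight (RingHom.id H)) (RightAct.mulRight_regular _) (coring.comul h')
      (takeuchi_right fun r => takeuchi r h') (coring.comul h)
  counit_unit : ∀ r r' x, coring.counit (s x * (s r * t (op r'))) = r' * x * r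
  counit_mul : ∀ h h' x,
    coring.counit (s x * (h * h')) = coring.counit (s (coring.counit (s x * h)) * h')

/-- A left bialgebroid over `L` with total algebra `H`; the bimodule structure of `H` is
`l h l' = s(l) t(l') h`. -/
structure LeftBialgebroid (k L H : Type*) [CommRing k] [Ring L] [Algebra k L] [Ring H]
    [Algebra k H] where
  /-- the source map -/
  s : L →ₐ[k] H
  /-- the target map -/
  t : Lᵐᵒᵖ →ₐ[k] H
  s_t_comm : ∀ l l', s l * t l' = t l' * s l
  coring : Coring (LeftAct.mulLeft (s : L →+* H)) (RightAct.mulLeft (t : Lᵐᵒᵖ →+* H))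
  /-- the coproduct has its range in the Takeuchi product -/
  takeuchi : ∀ l h,
    BTensor.rTensor (ρ' := RightAct.mulLeft (t : Lᵐᵒᵖ →+* H)) (LeftAct.mulLeft (s : L →+* H))
      (AddMonoidHom.mulRight (t (op l))) (RightAct.mulRight_mulLeft _ _) (coring.comul h) =
    BTensor.lTensor (RightAct.mulLeft (t : Lᵐᵒᵖ →+* H)) (AddMonoidHom.mulRight (s l))
      (LeftAct.mulRight_mulLeft _ _) (coring.comul h)
  comul_unit : ∀ l l', coring.comul (s l * t (op l')) = BTensor.mk _ _ (s l) (t (op l'))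
  comul_mul : ∀ h h', coring.comul (h * h') =
    takeuchiMulLeft (fun l => (t : Lᵐᵒᵖ →+* H) (op l)) (s : L →+* H)
      (RightAct.mulLeft_act _) (RightAct.mulRight (RingHom.id H)) (RightAct.regular_mulLeft _) (coring.comul h)
      (takeuchi_left fun l => takeuchi l h) (coring.comul h')
  counit_unit : ∀ l l' x, coring.counit (s l * t (op l') * s x) = l * x * l'
  counit_mul : ∀ h h' x,
    coring.counit (h * h' * s x) = coring.counit (h * s (coring.counit (h' * s x)))

/-! ### Hopf algebroids -/

/-- A left and a right bialgebroid on the same total algebra `H` with compatible source and target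
maps. -/
structure HopfAlgebroidBase (k L R H : Type*) [CommRing k] [Ring L] [Algebra k L] [Ring R]
    [Algebra k R] [Ring H] [Algebra k H] where
  left : LeftBialgebroid k L H
  right : RightBialgebroid k R H
  sL_counit_tR : ∀ r, left.s (left.coring.counit (right.t r)) = right.t r
  tL_counit_sR : ∀ r, left.t (op (left.coring.counit (right.s r))) = right.s r
  sR_counit_tL : ∀ l, right.s (right.coring.counit (left.t l)) = left.t l
  tR_counit_sL : ∀ l, right.t (op (right.coring.counit (left.s l))) = left.s l

namespace HopfAlgebroidBase

variable {k L R H : Type*} [CommRing k] [Ring L] [Algebra k L] [Ring R] [Algebra k R] [Ring H]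
  [Algebra k H] (X : HopfAlgebroidBase k L R H)

/-- The left `L`-module structure `l h = s_L(l) h` of `H`. -/
abbrev lactL : LeftAct L H := LeftAct.mulLeft (X.left.s : L →+* H)
/-- The right `L`-module structure `h l = t_L(l) h` of `H`. -/
abbrev ractL : RightAct L H := RightAct.mulLeft (X.left.t : Lᵐᵒᵖ →+* H)
/-- The left `R`-module structure `r h = h t_R(r)` of `H`. -/
abbrev lactR : LeftAct R H := LeftAct.mulRight (X.right.t : Rᵐᵒᵖ →+* H)
/-- The right `R`-module structure `h r = h s_R(r)` of `H`. -/
abbrev ractR : RightAct R H := RightAct.mulRight (X.right.s : R →+* H)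
/-- The coproduct `Δ_L`. -/
abbrev comulL : H →+ BTensor X.ractL X.lactL := X.left.coring.comul
/-- The coproduct `Δ_R`. -/
abbrev comulR : H →+ BTensor X.ractR X.lactR := X.right.coring.comul
/-- The counit `ε_L`. -/
abbrev counitL : H →+ L := X.left.coring.counit
/-- The counit `ε_R`. -/
abbrev counitR : H →+ R := X.right.coring.counit

theorem ractL_lactR (r : R) (l : L) (h : H) :
    X.ractL.act l (X.lactR.act r h) = X.lactR.act r (X.ractL.act l h) := by
  simp [mul_assoc]

theorem ractR_lactL (l : L) (r : R) (h : H) :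
    X.ractR.act r (X.lactL.act l h) = X.lactL.act l (X.ractR.act r h) := by
  simp [mul_assoc]

theorem comulL_mul_sL (h : H) (l : L) : X.comulL (h * X.left.s l) =
    BTensor.rTensor (ρ' := X.ractL) X.lactL (AddMonoidHom.mulRight (X.left.s l))
      (RightAct.mulRight_mulLeft _ _) (X.comulL h) := by
  have h1 : X.comulL (X.left.s l) = BTensor.mk _ _ (X.left.s l) 1 := by
    simpa using X.left.comul_unit l 1
  rw [X.left.comul_mul, h1, takeuchiMulLeft_mk]
  induction X.comulL h using BTensor.induction_on with
  | zero => simp only [map_zero]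
  | tmul a b => simp
  | add x y hx hy => rw [map_add, hx, hy, map_add]

theorem comulL_mul_tL (h : H) (l : L) : X.comulL (h * X.left.t (op l)) =
    BTensor.lTensor X.ractL (AddMonoidHom.mulRight (X.left.t (op l)))
      (LeftAct.mulRight_mulLeft _ _) (X.comulL h) := by
  have h1 : X.comulL (X.left.t (op l)) = BTensor.mk _ _ 1 (X.left.t (op l)) := by
    simpa using X.left.comul_unit 1 l
  rw [X.left.comul_mul, h1, takeuchiMulLeft_mk]
  induction X.comulL h using BTensor.induction_on with
  | zero => simp only [map_zero]
  | tmul a b => simp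
  | add x y hx hy => rw [map_add, hx, hy, map_add]

theorem comulR_sR_mul (h : H) (r : R) : X.comulR (X.right.s r * h) =
    BTensor.lTensor X.ractR (AddMonoidHom.mulLeft (X.right.s r))
      (LeftAct.mulLeft_mulRight _ _) (X.comulR h) := by
  have h1 : X.comulR (X.right.s r) = BTensor.mk _ _ 1 (X.right.s r) := by
    simpa using X.right.comul_unit r 1
  rw [X.right.comul_mul, h1, takeuchiMulRight_mk]
  induction X.comulR h using BTensor.induction_on with
  | zero => simp only [map_zero]
  | tmul a b => simp
  | add x y hx hy => rw [map_add, hx, hy, map_add]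

theorem comulR_tR_mul (h : H) (r : R) : X.comulR (X.right.t (op r) * h) =
    BTensor.rTensor (ρ' := X.ractR) X.lactR (AddMonoidHom.mulLeft (X.right.t (op r)))
      (RightAct.mulLeft_mulRight (RightAct.mulRight_act _) _) (X.comulR h) := by
  have h1 : X.comulR (X.right.t (op r)) = BTensor.mk _ _ (X.right.t (op r)) 1 := by
    simpa using X.right.comul_unit 1 r
  rw [X.right.comul_mul, h1, takeuchiMulRight_mk]
  induction X.comulR h using BTensor.induction_on with
  | zero => simp only [map_zero]
  | tmul a b => simp
  | add x y hx hy => rw [map_add, hx, hy, map_add]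

theorem comulL_one : X.comulL 1 = BTensor.mk _ _ 1 1 := by
  simpa using X.left.comul_unit 1 1

theorem comulR_one : X.comulR 1 = BTensor.mk _ _ 1 1 := by
  simpa using X.right.comul_unit 1 1

/-- `Δ_L` is left `R`-linear. -/
theorem comulL_lactR (r : R) (h : H) : X.comulL (X.lactR.act r h) =
    BTensor.rTensor X.lactL (X.lactR.act r) (fun b n => (X.ractL_lactR r b n).symm)
      (X.comulL h) := by
  have e := X.sL_counit_tR (op r)
  have := X.comulL_mul_sL h (X.left.coring.counit (X.right.t (op r)))
  simp only [e] at this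
  exact this

/-- `Δ_L` is right `R`-linear. -/
theorem comulL_ractR (r : R) (h : H) : X.comulL (X.ractR.act r h) =
    (BTensor.rightAct X.ractL X.lactL X.ractR X.ractR_lactL).act r (X.comulL h) := by
  have e := X.tL_counit_sR r
  have := X.comulL_mul_tL h (X.left.coring.counit (X.right.s r))
  simp only [e] at this
  exact this

/-- `Δ_R` is left `L`-linear. -/
theorem comulR_lactL (l : L) (h : H) : X.comulR (X.lactL.act l h) =
    BTensor.rTensor X.lactR (X.lactL.act l) (fun b n => (X.ractR_lactL l b n).symm)
      (X.comulR h) := by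
  have e := X.tR_counit_sL l
  have := X.comulR_tR_mul h (X.right.coring.counit (X.left.s l))
  simp only [e] at this
  exact this

/-- `Δ_R` is right `L`-linear. -/
theorem comulR_ractL (l : L) (h : H) : X.comulR (X.ractL.act l h) =
    (BTensor.rightAct X.ractR X.lactR X.ractL X.ractL_lactR).act l (X.comulR h) := by
  have e := X.sR_counit_tL (op l)
  have := X.comulR_sR_mul h (X.right.coring.counit (X.left.t (op l)))
  simp only [e] at this
  exact this

end HopfAlgebroidBase

/-- A Hopf algebroid with total algebra `H` over the base algebras `L` and `R`; the antipode `S`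
is not assumed to be bijective. -/
structure HopfAlgebroid (k L R H : Type*) [CommRing k] [Ring L] [Algebra k L] [Ring R]
    [Algebra k R] [Ring H] [Algebra k H] extends HopfAlgebroidBase k L R H where
  /-- `(Δ_L ⊗_R H) ∘ Δ_R = (H ⊗_L Δ_R) ∘ Δ_L` -/
  comulL_comulR : ∀ h,
    BTensor.rTensor toHopfAlgebroidBase.lactR toHopfAlgebroidBase.comulL
        toHopfAlgebroidBase.comulL_ractR (toHopfAlgebroidBase.comulR h) =
      BTensor.insert toHopfAlgebroidBase.ractL toHopfAlgebroidBase.lactL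
        toHopfAlgebroidBase.ractR toHopfAlgebroidBase.lactR toHopfAlgebroidBase.ractR_lactL
        toHopfAlgebroidBase.comulR toHopfAlgebroidBase.comulR_lactL (toHopfAlgebroidBase.comulL h)
  /-- `(Δ_R ⊗_L H) ∘ Δ_L = (H ⊗_R Δ_L) ∘ Δ_R` -/
  comulR_comulL : ∀ h,
    BTensor.rTensor toHopfAlgebroidBase.lactL toHopfAlgebroidBase.comulR
        toHopfAlgebroidBase.comulR_ractL (toHopfAlgebroidBase.comulL h) =
      BTensor.insert toHopfAlgebroidBase.ractR toHopfAlgebroidBase.lactR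
        toHopfAlgebroidBase.ractL toHopfAlgebroidBase.lactL toHopfAlgebroidBase.ractL_lactR
        toHopfAlgebroidBase.comulL toHopfAlgebroidBase.comulL_lactR (toHopfAlgebroidBase.comulR h)
  /-- the antipode -/
  S : H →ₗ[k] H
  S_bimod : ∀ r l h, S (left.t (op l) * h * right.t (op r)) = right.s r * S h * left.s l
  /-- `S(h₍₁₎) h₍₂₎ = s_R(ε_R(h))` -/
  S_mul_id : ∀ h, BTensor.mulMap S.toAddMonoidHom (AddMonoidHom.id H)
    (fun l x y => by simpa [mul_assoc] using congrArg (· * y) (S_bimod 1 l x))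
    (toHopfAlgebroidBase.comulL h) = right.s (toHopfAlgebroidBase.counitR h)
  /-- `h⁽¹⁾ S(h⁽²⁾) = s_L(ε_L(h))` -/
  id_mul_S : ∀ h, BTensor.mulMap (AddMonoidHom.id H) S.toAddMonoidHom
    (fun r x y => by simpa [mul_assoc] using congrArg (x * ·) (S_bimod r 1 y).symm)
    (toHopfAlgebroidBase.comulR h) = left.s (toHopfAlgebroidBase.counitL h)

namespace HopfAlgebroid

variable {k L R H : Type*} [CommRing k] [Ring L] [Algebra k L] [Ring R] [Algebra k R] [Ring H]
  [Algebra k H]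

/-! ### Comodules of a Hopf algebroid -/

/-- The structure of a right comodule of the Hopf algebroid `𝓗` on `M`. -/
structure Comodule (𝓗 : HopfAlgebroid k L R H) (M : Type*) [AddCommGroup M] where
  actR : RightAct R M
  actL : RightAct L M
  /-- the coaction `m ↦ m⁽⁰⁾ ⊗_R m⁽¹⁾` -/
  coR : Coaction 𝓗.right.coring actR
  /-- the coaction `m ↦ m₍₀₎ ⊗_L m₍₁₎` -/
  coL : Coaction 𝓗.left.coring actL
  coR_actL : ∀ l m, coR.coact (actL.act l m) =
    (BTensor.rightAct actR 𝓗.lactR 𝓗.ractL 𝓗.ractL_lactR).act l (coR.coact m)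
  coL_actR : ∀ r m, coL.coact (actR.act r m) =
    (BTensor.rightAct actL 𝓗.lactL 𝓗.ractR 𝓗.ractR_lactL).act r (coL.coact m)
  /-- `(M ⊗_R Δ_L) ∘ ϱ_R = (ϱ_R ⊗_L H) ∘ ϱ_L` -/
  comulL_coR : ∀ m,
    BTensor.insert actR 𝓗.lactR 𝓗.ractL 𝓗.lactL 𝓗.ractL_lactR 𝓗.comulL 𝓗.comulL_lactR
        (coR.coact m) =
      BTensor.rTensor 𝓗.lactL coR.coact coR_actL (coL.coact m)
  /-- `(M ⊗_L Δ_R) ∘ ϱ_L = (ϱ_L ⊗_R H) ∘ ϱ_R` -/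
  comulR_coL : ∀ m,
    BTensor.insert actL 𝓗.lactL 𝓗.ractR 𝓗.lactR 𝓗.ractR_lactL 𝓗.comulR 𝓗.comulR_lactL
        (coL.coact m) =
      BTensor.rTensor 𝓗.lactR coL.coact coL_actR (coR.coact m)

namespace Comodule

variable {𝓗 : HopfAlgebroid k L R H} {M : Type*} [AddCommGroup M] (X : 𝓗.Comodule M)

theorem act_comm (r : R) (l : L) (m : M) :
    X.actR.act r (X.actL.act l m) = X.actL.act l (X.actR.act r m) := by
  have : X.coR.coact (X.actR.act r (X.actL.act l m)) =
      X.coR.coact (X.actL.act l (X.actR.act r m)) := by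
    rw [X.coR.coact_act, X.coR_actL, X.coR_actL, X.coR.coact_act]
    induction X.coR.coact m using BTensor.induction_on with
    | zero => simp only [map_zero]
    | tmul a b => simp [mul_assoc]
    | add x y hx hy => simp only [map_add, hx, hy]
  rw [← X.coR.counit (X.actR.act r (X.actL.act l m)), this, X.coR.counit]

/-- The range of the `H_L`-coaction is in the Takeuchi product: the right action of `l` via
`R ≅ Lᵒᵖ` on the first factor is the right multiplication by `s_L(l)` on the second one. -/
theorem takeuchiL (l : L) (m : M) :
    BTensor.rTensor (ρ' := X.actL) 𝓗.lactL (X.actR.act (𝓗.counitR (𝓗.left.t (op l))))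
        (X.act_comm _) (X.coL.coact m) =
      BTensor.lTensor X.actL (AddMonoidHom.mulRight (𝓗.left.s l))
        (LeftAct.mulRight_mulLeft _ _) (X.coL.coact m) := by
  have hsR : 𝓗.right.s (𝓗.counitR (𝓗.left.t (op l))) = 𝓗.left.t (op l) := 𝓗.sR_counit_tL _
  -- `e h = ε_L(h t_L(l))`
  let e : H →+ L := 𝓗.counitL.comp (AddMonoidHom.mulRight (𝓗.left.t (op l)))
  have heL : ∀ a n, e (𝓗.lactL.act a n) = a * e n := fun a n => by
    have := 𝓗.left.coring.counit_lact a (n * 𝓗.left.t (op l))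
    simpa [e, mul_assoc] using this
  have heR : ∀ a n, e (𝓗.ractL.act a n) = e n * a := fun a n => by
    have := 𝓗.left.coring.counit_ract a (n * 𝓗.left.t (op l))
    simpa [e, mul_assoc] using this
  have hK : ∀ n, X.actR.act (𝓗.counitR (𝓗.left.t (op l))) n =
      BTensor.contractRight X.actL e heL (X.coL.coact n) := fun n => by
    rw [← X.coL.counit (X.actR.act _ n), X.coL_actR]
    induction X.coL.coact n using BTensor.induction_on with
    | zero => simp only [map_zero]
    | tmul a b => simp [e, hsR]
    | add x y hx hy => simp only [map_add, hx, hy]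
  have hE : ∀ h, BTensor.contractLeft 𝓗.lactL e heR (𝓗.comulL h) = h * 𝓗.left.s l := fun h => by
    have h1 := 𝓗.left.takeuchi l h
    have h2 := 𝓗.left.coring.counit_left h
    have h3 := congrArg (BTensor.contractLeft 𝓗.lactL 𝓗.counitL 𝓗.left.coring.counit_ract) h1
    trans BTensor.contractLeft 𝓗.lactL 𝓗.counitL 𝓗.left.coring.counit_ract
      (BTensor.rTensor (ρ' := 𝓗.ractL) 𝓗.lactL (AddMonoidHom.mulRight (𝓗.left.t (op l)))
        (RightAct.mulRight_mulLeft _ _) (𝓗.comulL h))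
    · induction 𝓗.comulL h using BTensor.induction_on with
      | zero => simp only [map_zero]
      | tmul a b => simp [e]
      | add x y hx hy => simp only [map_add, hx, hy]
    · refine h3.trans ?_
      refine Eq.trans ?_ (congrArg (· * 𝓗.left.s l) h2)
      induction 𝓗.left.coring.comul h using BTensor.induction_on with
      | zero => simp only [map_zero, zero_mul]
      | tmul a b => simp [mul_assoc]
      | add x y hx hy => simp only [map_add, hx, hy, add_mul]
  have hKL : ∀ b n, BTensor.contractRight X.actL e heL
      ((BTensor.rightAct X.actL 𝓗.lactL 𝓗.ractL 𝓗.left.coring.act_comm).act b n) =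
      X.actL.act b (BTensor.contractRight X.actL e heL n) := fun b n => by
    induction n using BTensor.induction_on with
    | zero => simp only [map_zero]
    | tmul x y =>
      rw [BTensor.rightAct_mk, BTensor.contractRight_mk, BTensor.contractRight_mk, heR,
        X.actL.mul_act]
    | add x y hx hy => simp only [map_add, hx, hy]
  trans BTensor.rTensor (ρ' := X.actL) 𝓗.lactL (BTensor.contractRight X.actL e heL) hKL
    (BTensor.rTensor 𝓗.lactL X.coL.coact X.coL.coact_act (X.coL.coact m))
  · induction X.coL.coact m using BTensor.induction_on with
    | zero => simp only [map_zero]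
    | tmul a b => simp [hK]
    | add x y hx hy => simp only [map_add, hx, hy]
  · rw [X.coL.coassoc]
    induction X.coL.coact m using BTensor.induction_on with
    | zero => simp only [map_zero]
    | tmul a b =>
      rw [BTensor.insert_mk, BTensor.lTensor_mk, AddMonoidHom.mulRight_apply, ← hE b]
      induction 𝓗.left.coring.comul b using BTensor.induction_on with
      | zero => simp only [map_zero]
      | tmul x y => simp [BTensor.mk_balanced]
      | add x y hx hy => simp only [map_add, hx, hy]
    | add x y hx hy => simp only [map_add, hx, hy]

/-- The Takeuchi condition, for a right `A`-module structure that induces the right `R`-module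
structure along `u : R → A`. -/
theorem takeuchiL_act {A : Type*} [Ring A] (u : R → A) (act : RightAct A M)
    (hu : ∀ r m, X.actR.act r m = act.act (u r) m)
    (hact : ∀ a l m, act.act a (X.actL.act l m) = X.actL.act l (act.act a m)) (m : M) (l : L) :
    BTensor.rTensor (ρ' := X.actL) 𝓗.lactL (act.act (u (𝓗.counitR (𝓗.left.t (op l)))))
        (hact _) (X.coL.coact m) =
      BTensor.lTensor X.actL (AddMonoidHom.mulRight ((𝓗.left.s : L →+* H) l))
        (LeftAct.mulRight_mulLeft _ _) (X.coL.coact m) := by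
  have h := X.takeuchiL l m
  have e : X.actR.act (𝓗.counitR (𝓗.left.t (op l))) =
      act.act (u (𝓗.counitR (𝓗.left.t (op l)))) := by
    ext m
    exact hu _ m
  simp only [e] at h
  exact h

/-- `f` is a morphism of right comodules of the Hopf algebroid. -/
structure IsHom {N : Type*} [AddCommGroup N] (X : 𝓗.Comodule M) (Y : 𝓗.Comodule N)
    (f : M →+ N) : Prop where
  map_actR : ∀ r m, f (X.actR.act r m) = Y.actR.act r (f m)
  map_actL : ∀ l m, f (X.actL.act l m) = Y.actL.act l (f m)
  coR : ∀ m, Y.coR.coact (f m) = BTensor.rTensor 𝓗.lactR f map_actR (X.coR.coact m)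
  coL : ∀ m, Y.coL.coact (f m) = BTensor.rTensor 𝓗.lactL f map_actL (X.coL.coact m)

end Comodule

/-- The total algebra as a right comodule, with coactions `Δ_R` and `Δ_L`. -/
def regularComodule (𝓗 : HopfAlgebroid k L R H) : 𝓗.Comodule H where
  actR := 𝓗.ractR
  actL := 𝓗.ractL
  coR :=
    { coact := 𝓗.comulR
      coact_act := 𝓗.right.coring.comul_ract
      coassoc := 𝓗.right.coring.coassoc
      counit := 𝓗.right.coring.counit_right }
  coL :=
    { coact := 𝓗.comulL
      coact_act := 𝓗.left.coring.comul_ract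
      coassoc := 𝓗.left.coring.coassoc
      counit := 𝓗.left.coring.counit_right }
  coR_actL := 𝓗.comulR_ractL
  coL_actR := 𝓗.comulL_ractR
  comulL_coR h := (𝓗.comulR_comulL h).symm
  comulR_coL h := (𝓗.comulL_comulR h).symm

/-! ### Comodule algebras and cleft extensions -/

theorem regular_of_mul {A K : Type*} [Ring A] [Ring K] {ρ : RightAct K A} {u : K → A}
    (h : ∀ r a, ρ.act r a = a * u r) (r : K) (a : A) :
    ρ.act r a = (RightAct.mulRight (RingHom.id A)).act (u r) a := h r a

theorem regular_comm {A K : Type*} [Ring A] [Ring K] {ρ : RightAct K A} {u : K → A}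
    (h : ∀ r a, ρ.act r a = u r * a) (b : A) (r : K) (a : A) :
    (RightAct.mulRight (RingHom.id A)).act b (ρ.act r a) =
      ρ.act r ((RightAct.mulRight (RingHom.id A)).act b a) := by
  simp [h, mul_assoc]

/-- The structure of a right comodule algebra of the Hopf algebroid `𝓗` on the algebra `A`, that
is, of an `R`-ring and a right `𝓗`-comodule whose unit `R → A` and multiplication
`A ⊗_R A → A` are morphisms of comodules. The right `L`-action on `R` is
`r l = ε_R(t_L(l)) r`, and on `A ⊗_R A` it is `(a ⊗ a') l = a l ⊗ a'`. -/
structure ComoduleAlgebra (𝓗 : HopfAlgebroid k L R H) (A : Type*) [Ring A] [Algebra k A]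
    extends 𝓗.Comodule A where
  /-- the unit map of the `R`-ring `A` -/
  unit : R →ₐ[k] A
  actR_eq : ∀ r a, actR.act r a = a * unit r
  actL_eq : ∀ l a, actL.act l a = unit (𝓗.counitR (𝓗.left.t (op l))) * a
  /-- the `H_R`-coaction has its range in the Takeuchi product -/
  takeuchi : ∀ a r,
    BTensor.rTensor (ρ' := actR) 𝓗.lactR (AddMonoidHom.mulLeft (unit r))
        (RightAct.mulLeft_mulRight actR_eq _) (coR.coact a) =
      BTensor.lTensor actR (AddMonoidHom.mulLeft ((𝓗.right.t : Rᵐᵒᵖ →+* H) (op r)))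
        (LeftAct.mulLeft_mulRight _ _) (coR.coact a)
  coR_one : coR.coact 1 = BTensor.mk _ _ 1 1
  coL_one : coL.coact 1 = BTensor.mk _ _ 1 1
  coR_mul : ∀ a a', coR.coact (a * a') =
    takeuchiMulRight unit (𝓗.right.t : Rᵐᵒᵖ →+* H) actR_eq
      (RightAct.mulRight (RingHom.id A)) (regular_of_mul actR_eq) (coR.coact a') (takeuchi a')
      (coR.coact a)
  coL_mul : ∀ a a', coL.coact (a * a') =
    takeuchiMulLeft (fun l => unit (𝓗.counitR (𝓗.left.t (op l)))) (𝓗.left.s : L →+* H) actL_eq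
      (RightAct.mulRight (RingHom.id A)) (regular_comm actL_eq) (coL.coact a)
      (toComodule.takeuchiL_act unit _ (regular_of_mul actR_eq) (regular_comm actL_eq) a)
      (coL.coact a')

namespace ComoduleAlgebra

variable {𝓗 : HopfAlgebroid k L R H} {A : Type*} [Ring A] [Algebra k A]

/-- The `H_R`-coinvariants of `A`: all `b` with `ϱ_R(b a) = b ϱ_R(a)` for all `a`. -/
def coinvariants (𝒜 : 𝓗.ComoduleAlgebra A) : Set A :=
  {b | ∀ a, 𝒜.coR.coact (b * a) =
    BTensor.rTensor 𝓗.lactR (AddMonoidHom.mulLeft b)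
      (RightAct.mulLeft_mulRight 𝒜.actR_eq b) (𝒜.coR.coact a)}

/-- The extension of the coinvariants `B` by `A` is cleft with respect to the `L`-ring structure
`unitL : L → B ⊆ A`, with cleaving map `j` and convolution inverse `j'`. -/
structure IsCleaving (𝒜 : 𝓗.ComoduleAlgebra A) (unitL : L →ₐ[k] A) (j j' : H →ₗ[k] A) :
    Prop where
  unitL_mem : ∀ l, unitL l ∈ 𝒜.coinvariants
  j_left : ∀ l h, j (𝓗.left.s l * h) = unitL l * j h
  j_hom : Comodule.IsHom 𝓗.regularComodule 𝒜.toComodule j.toAddMonoidHom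
  j'_bimod : ∀ r l h,
    j' (𝓗.left.t (op l) * h * 𝓗.right.t (op r)) = 𝒜.unit r * j' h * unitL l
  /-- `j(h⁽¹⁾) j'(h⁽²⁾) = unitL(ε_L(h))` -/
  j_mul_j' : ∀ h, BTensor.mulMap j.toAddMonoidHom j'.toAddMonoidHom
    (fun r x y => by
      have h1 : j (x * 𝓗.right.s r) = j x * 𝒜.unit r :=
        (j_hom.map_actR r x).trans (𝒜.actR_eq r (j x))
      have h2 := j'_bimod r 1 y
      simp only [op_one, map_one, one_mul, mul_one] at h2
      simp [h1, h2, mul_assoc]) (𝓗.comulR h) = unitL (𝓗.counitL h)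
  /-- `j'(h₍₁₎) j(h₍₂₎) = unit(ε_R(h))` -/
  j'_mul_j : ∀ h, BTensor.mulMap j'.toAddMonoidHom j.toAddMonoidHom
    (fun l x y => by
      have h1 := j_left l y
      have h2 := j'_bimod 1 l x
      simp only [op_one, map_one, one_mul, mul_one] at h2
      simp [h1, h2, mul_assoc]) (𝓗.comulL h) = 𝒜.unit (𝓗.counitR h)

end ComoduleAlgebra

/-- The total algebra as a right comodule algebra. -/
def regular (𝓗 : HopfAlgebroid k L R H) : 𝓗.ComoduleAlgebra H where
  toComodule := 𝓗.regularComodule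
  unit := 𝓗.right.s
  actR_eq _ _ := rfl
  actL_eq l a := congrArg (· * a) (𝓗.sR_counit_tL (op l)).symm
  takeuchi a r := 𝓗.right.takeuchi r a
  coR_one := 𝓗.comulR_one
  coL_one := 𝓗.comulL_one
  coR_mul := 𝓗.right.comul_mul
  coL_mul a a' := (𝓗.left.comul_mul a a').trans
    (DFunLike.congr_fun (BTensor.hom_ext fun _ _ => rfl) _)

/-! ### Relative Hopf modules -/

/-- A right-right relative Hopf module: a right module of the monoid `A` in the category of right
`𝓗`-comodules, that is, a right `𝓗`-comodule `M` and right `A`-module such that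
`M ⊗_R A → M` is a morphism of comodules. -/
structure HopfModule {𝓗 : HopfAlgebroid k L R H} {A : Type*} [Ring A] [Algebra k A]
    (𝒜 : 𝓗.ComoduleAlgebra A) where
  carrier : Type w
  [addCommGroup : AddCommGroup carrier]
  comodule : 𝓗.Comodule carrier
  act : RightAct A carrier
  actR_eq : ∀ r m, comodule.actR.act r m = act.act (𝒜.unit r) m
  act_actL : ∀ a l m,
    act.act a (comodule.actL.act l m) = comodule.actL.act l (act.act a m)
  /-- `ϱ_R(m a) = m⁽⁰⁾ a⁽⁰⁾ ⊗_R m⁽¹⁾ a⁽¹⁾` -/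
  coR_act : ∀ m a, comodule.coR.coact (act.act a m) =
    takeuchiMulRight 𝒜.unit (𝓗.right.t : Rᵐᵒᵖ →+* H) 𝒜.actR_eq act actR_eq
      (𝒜.coR.coact a) (𝒜.takeuchi a) (comodule.coR.coact m)
  /-- `ϱ_L(m a) = m₍₀₎ a₍₀₎ ⊗_L m₍₁₎ a₍₁₎` -/
  coL_act : ∀ m a, comodule.coL.coact (act.act a m) =
    takeuchiMulLeft (fun l => 𝒜.unit (𝓗.counitR (𝓗.left.t (op l)))) (𝓗.left.s : L →+* H)
      𝒜.actL_eq act act_actL (comodule.coL.coact m)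
      (comodule.takeuchiL_act 𝒜.unit act actR_eq act_actL m) (𝒜.coL.coact a)

namespace HopfModule

variable {𝓗 : HopfAlgebroid k L R H} {A : Type*} [Ring A] [Algebra k A]
  {𝒜 : 𝓗.ComoduleAlgebra A}

instance (M : HopfModule 𝒜) : AddCommGroup M.carrier := M.addCommGroup

/-- Morphisms of relative Hopf modules: maps of right `A`-modules and right `𝓗`-comodules. -/
@[ext] structure Hom (M N : HopfModule 𝒜) where
  toFun : M.carrier →+ N.carrier
  map_act : ∀ a m, toFun (M.act.act a m) = N.act.act a (toFun m)
  isHom : Comodule.IsHom M.comodule N.comodule toFun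

/-- The category of relative Hopf modules. -/
instance : Category (HopfModule 𝒜) where
  Hom M N := Hom M N
  id M :=
    { toFun := AddMonoidHom.id _
      map_act := fun _ _ => rfl
      isHom :=
        { map_actR := fun _ _ => rfl
          map_actL := fun _ _ => rfl
          coR := fun m => (BTensor.rTensor_id _).symm
          coL := fun m => (BTensor.rTensor_id _).symm } }
  comp f g :=
    { toFun := g.toFun.comp f.toFun
      map_act := fun a m => by simp [f.map_act, g.map_act]
      isHom :=
        { map_actR := fun a m => by simp [f.isHom.map_actR, g.isHom.map_actR]
          map_actL := fun a m => by simp [f.isHom.map_actL, g.isHom.map_actL]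
          coR := fun m => by
            rw [BTensor.rTensor_comp f.toFun g.toFun f.isHom.map_actR g.isHom.map_actR,
              ← f.isHom.coR, ← g.isHom.coR, AddMonoidHom.comp_apply]
          coL := fun m => by
            rw [BTensor.rTensor_comp f.toFun g.toFun f.isHom.map_actL g.isHom.map_actL,
              ← f.isHom.coL, ← g.isHom.coL, AddMonoidHom.comp_apply] } }

end HopfModule

/-! ### The induction functor -/

section Induction

variable (𝓗 : HopfAlgebroid k L R H) {W : Type*} [AddCommGroup W] (ρ : RightAct L W)

/-- The right `𝓗`-comodule `W ⊗_L H`, for a right `L`-module `W`, with coactions `W ⊗_L Δ_R` and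
`W ⊗_L Δ_L`. -/
def inducedComodule : 𝓗.Comodule (BTensor ρ 𝓗.lactL) where
  actR := BTensor.rightAct ρ 𝓗.lactL 𝓗.ractR 𝓗.ractR_lactL
  actL := BTensor.rightAct ρ 𝓗.lactL 𝓗.ractL 𝓗.left.coring.act_comm
  coR :=
    { coact := BTensor.insert ρ 𝓗.lactL 𝓗.ractR 𝓗.lactR 𝓗.ractR_lactL 𝓗.comulR 𝓗.comulR_lactL
      coact_act := BTensor.insert_rightAct ρ _ _ _ _ 𝓗.comulR_lactL 𝓗.right.coring.comul_ract
      coassoc := BTensor.insert_coassoc ρ _ _ _ _ _ 𝓗.comulR_lactL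
        𝓗.right.coring.comul_lact 𝓗.comulR_lactL 𝓗.right.coring.comul_ract
        𝓗.right.coring.coassoc
      counit := BTensor.insert_counit ρ _ _ 𝓗.comulR_lactL _ _ 𝓗.right.coring.counit_right }
  coL :=
    { coact := BTensor.insert ρ 𝓗.lactL 𝓗.ractL 𝓗.lactL 𝓗.left.coring.act_comm 𝓗.comulL
        𝓗.left.coring.comul_lact
      coact_act := BTensor.insert_rightAct ρ _ _ _ _ 𝓗.left.coring.comul_lact 𝓗.left.coring.comul_ract
      coassoc := BTensor.insert_coassoc ρ _ _ _ _ _ 𝓗.left.coring.comul_lact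
        𝓗.left.coring.comul_lact 𝓗.left.coring.comul_lact 𝓗.left.coring.comul_ract
        𝓗.left.coring.coassoc
      counit := BTensor.insert_counit ρ _ _ 𝓗.left.coring.comul_lact _ _ 𝓗.left.coring.counit_right }
  coR_actL := BTensor.insert_rightAct ρ _ _ _ _ 𝓗.comulR_lactL 𝓗.comulR_ractL
  coL_actR := BTensor.insert_rightAct ρ _ _ _ _ 𝓗.left.coring.comul_lact 𝓗.comulL_ractR
  comulL_coR x := (BTensor.insert_coassoc ρ _ _ _ _ _ 𝓗.left.coring.comul_lact
    𝓗.comulL_lactR 𝓗.comulR_lactL 𝓗.comulR_ractL 𝓗.comulR_comulL x).symm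
  comulR_coL x := (BTensor.insert_coassoc ρ _ _ _ _ _ 𝓗.comulR_lactL
    𝓗.comulR_lactL 𝓗.left.coring.comul_lact 𝓗.comulL_ractR 𝓗.comulL_comulR x).symm

end Induction

section InductionFunctor

variable {k : Type uk} {L : Type uL} {R : Type uR} {H : Type uH} [CommRing k] [Ring L]
  [Algebra k L] [Ring R] [Algebra k R] [Ring H] [Algebra k H] (𝓗 : HopfAlgebroid k L R H)

theorem regular_lactL (l : L) (h : H) (x : H) :
    (RightAct.mulRight (RingHom.id H)).act h (𝓗.lactL.act l x) =
      𝓗.lactL.act l ((RightAct.mulRight (RingHom.id H)).act h x) := mul_assoc _ _ _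

/-- The relative Hopf module `W ⊗_L H`, for a right `L`-module `W`, with the right `H`-action
`(w ⊗ h) h' = w ⊗ h h'`. -/
def inducedModule {W : Type w} [AddCommGroup W] (ρ : RightAct L W) :
    HopfModule.{max w uH} 𝓗.regular where
  carrier := BTensor ρ 𝓗.lactL
  comodule := 𝓗.inducedComodule ρ
  act := BTensor.rightAct ρ 𝓗.lactL (RightAct.mulRight (RingHom.id H)) 𝓗.regular_lactL
  actR_eq r m := by
    refine DFunLike.congr_fun (f := (𝓗.inducedComodule ρ).actR.act r) ?_ m
    exact BTensor.hom_ext fun _ _ => rfl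
  act_actL := BTensor.rightAct_comm _ _ (RightAct.regular_mulLeft _)
  coR_act m a := by
    induction m using BTensor.induction_on with
    | zero => simp only [map_zero]
    | tmul w h =>
      refine (congrArg (BTensor.tmulLeft ρ 𝓗.lactL 𝓗.ractR 𝓗.lactR 𝓗.ractR_lactL w)
        (𝓗.right.comul_mul h a)).trans ?_
      exact takeuchiMulRight_natural _ _ _ _ _ _ _ (BTensor.mk ρ 𝓗.lactL w) _
        (fun _ _ => rfl) _ _ _
    | add x y hx hy => simp only [map_add, hx, hy]
  coL_act m a := by
    induction m using BTensor.induction_on with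
    | zero =>
      refine ((congrArg _ (map_zero _)).trans (map_zero _)).trans ?_
      exact (takeuchiMulLeft_zero _ _ _ _ _ _ _ (map_zero _) _).symm
    | tmul w h =>
      refine (congrArg (BTensor.tmulLeft ρ 𝓗.lactL 𝓗.ractL 𝓗.lactL 𝓗.left.coring.act_comm w)
        (𝓗.regular.coL_mul h a)).trans ?_
      exact takeuchiMulLeft_natural _ _ _ _ _ _ _ (BTensor.mk ρ 𝓗.lactL w) _
        (fun _ _ => rfl) _ _ _ _ rfl _
    | add x y hx hy =>
      refine ((congrArg _ (map_add _ x y)).trans (map_add _ _ _)).trans ?_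
      refine (congrArg₂ (· + ·) hx hy).trans ?_
      exact (takeuchiMulLeft_add _ _ _ _ _ _ _ _ _ _ _ (map_add _ _ _) _).symm

/-- The functor `- ⊗_L H` from right `L`-modules to relative Hopf modules. -/
def inductionFunctor : ModuleCat.{max w uH} Lᵐᵒᵖ ⥤
    HopfModule.{max w uH} 𝓗.regular where
  obj W := 𝓗.inducedModule (RightAct.ofModule L W)
  map f :=
    { toFun := BTensor.rTensor (ρ' := RightAct.ofModule L _) 𝓗.lactL f.hom.toAddMonoidHom
        (fun a m => f.hom.map_smul (op a) m)
      map_act := fun a m => BTensor.rTensor_rightAct _ _ _ a m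
      isHom :=
        { map_actR := fun a m => BTensor.rTensor_rightAct _ _ _ a m
          map_actL := fun a m => BTensor.rTensor_rightAct _ _ _ a m
          coR := fun m => BTensor.insert_rTensor _ _ _ _ 𝓗.comulR_lactL _ m
          coL := fun m => BTensor.insert_rTensor _ _ _ _ 𝓗.left.coring.comul_lact _ m } }
  map_id _ := HopfModule.Hom.ext (BTensor.hom_ext fun _ _ => rfl)
  map_comp _ _ := HopfModule.Hom.ext (BTensor.hom_ext fun _ _ => rfl)

end InductionFunctor

end HopfAlgebroid

/-!
The coinvariants of `H` are `s_L(L)`: if `Δ_R(b) = b ⊗ 1`, then `b = b S(1) = s_L(ε_L(b))` by the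
antipode axiom, and the antipode axioms also say that the identity of `H` has the convolution inverse
`S`.

For the equivalence, let `M` be a Hopf module and `E(m) = m⁽⁰⁾ S(m⁽¹⁾)`.  The inverse of the map
`M^{co} ⊗_L H → M`, `m ⊗ h ↦ m h`, is `m ↦ E(m₍₀₎) ⊗_L m₍₁₎`; no flatness is needed, since `E` itself
takes values in the coinvariants (`HopfModule.proj_mem`).  The usual proof of that fact uses that `S` is
anti-comultiplicative.  Here it is derived from the Galois map `n ⊗_L h ↦ n h⁽¹⁾ ⊗_R h⁽²⁾`, which is
defined on `N ⊗_L H` for every right `H`-module `N`.  This map is surjective (`galois_induction`), and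
after it `n ⊗ h ↦ n S(h)` becomes `n ⊗ h ↦ n s_L(ε_L(h))` (`contractS_galois`).  The second fact, applied
to `N ⊗_R H` with the diagonal action, gives
`n S(h⁽²⁾)⁽¹⁾ ⊗ h⁽¹⁾ S(h⁽²⁾)⁽²⁾ = n S(h) ⊗ 1` on the image of the Galois map, hence everywhere
(`contractS_insert_comulR`), and for `ϱ_R(m) = ∑ n ⊗ h` this is the coinvariance of `E(m)`.

Coinvariants are taken with respect to `ϱ_R`, but that the two maps are mutually inverse also uses
`ϱ_L(m) = m ⊗ 1` for coinvariant `m`; this is `Comodule.coL_of_coR`.  On an induced module `W ⊗_L H` the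
map `E` is `w ⊗ h ↦ w ε_L(h) ⊗ 1`, so its coinvariants are the elements `w ⊗ 1`, whence the functor is
fully faithful.
-/

/-! ### The antipode and the Galois map of a right `H`-module -/

namespace HopfAlgebroid

section Contraction

variable {k L R H : Type*} [CommRing k] [Ring L] [Algebra k L] [Ring R] [Algebra k R] [Ring H]
  [Algebra k H] (𝓗 : HopfAlgebroid k L R H)

theorem S_one : 𝓗.S 1 = 1 := by
  have e : 𝓗.counitR 1 = 1 := by simpa using 𝓗.right.counit_unit 1 1 1
  have h : 𝓗.S 1 * 1 = 𝓗.right.s (𝓗.counitR 1) := by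
    rw [← 𝓗.S_mul_id 1, 𝓗.comulL_one]
    rfl
  rw [← mul_one (𝓗.S 1), h, e, map_one]

theorem S_mul_tR (r : R) (h : H) : 𝓗.S (h * 𝓗.right.t (op r)) = 𝓗.right.s r * 𝓗.S h := by
  simpa using 𝓗.S_bimod r 1 h

theorem S_tL_mul (l : L) (h : H) : 𝓗.S (𝓗.left.t (op l) * h) = 𝓗.S h * 𝓗.left.s l := by
  simpa using 𝓗.S_bimod 1 l h

theorem counitL_sL (l : L) : 𝓗.counitL (𝓗.left.s l) = l := by
  simpa using 𝓗.left.counit_unit 1 1 l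

theorem comulR_sL (l : L) : 𝓗.comulR (𝓗.left.s l) = BTensor.mk _ _ (𝓗.left.s l) 1 := by
  have h := 𝓗.comulR_lactL l 1
  rw [𝓗.comulR_one] at h
  simpa using h

variable {N : Type*} [AddCommGroup N] {ρ : RightAct R N} (act : RightAct H N)
  (hρ : ∀ r n, ρ.act r n = act.act (𝓗.right.s r) n)

/-- For a right `H`-module `N`, the map `N ⊗_R H → N`, `n ⊗ h ↦ n S(h)`. -/
def contractS : BTensor ρ 𝓗.lactR →+ N :=
  BTensor.lift (act.act.flip.compl₂ 𝓗.S.toAddMonoidHom) (fun r n h => by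
    simp [hρ, S_mul_tR, act.mul_act])

@[simp] theorem contractS_mk (n : N) (h : H) :
    𝓗.contractS act hρ (BTensor.mk ρ 𝓗.lactR n h) = act.act (𝓗.S h) n := rfl

theorem flip_ractR {N : Type*} [AddCommGroup N] {ρ : RightAct R N} (act : RightAct H N)
    (hρ : ∀ r n, ρ.act r n = act.act (𝓗.right.s r) n) (n : N) (r : R) (h : H) :
    act.act.flip n (𝓗.ractR.act r h) = ρ.act r (act.act.flip n h) := by
  simp [hρ, act.mul_act]

/-- For a right `H`-module `N`, the Galois map `N ⊗_L H → N ⊗_R H`, `n ⊗ h ↦ n h⁽¹⁾ ⊗ h⁽²⁾`, as a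
function of two variables. -/
def galois (n : N) : H →+ BTensor ρ 𝓗.lactR :=
  (BTensor.rTensor (ρ := 𝓗.ractR) (ρ' := ρ) 𝓗.lactR (act.act.flip n)
    (𝓗.flip_ractR act hρ n)).comp 𝓗.comulR

theorem galois_apply (n : N) (h : H) : 𝓗.galois act hρ n h =
    BTensor.rTensor (ρ := 𝓗.ractR) (ρ' := ρ) 𝓗.lactR (act.act.flip n)
      (𝓗.flip_ractR act hρ n) (𝓗.comulR h) := rfl

theorem galois_add (n n' : N) (h : H) :
    𝓗.galois act hρ (n + n') h = 𝓗.galois act hρ n h + 𝓗.galois act hρ n' h := by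
  rw [galois_apply, galois_apply, galois_apply]
  induction 𝓗.comulR h using BTensor.induction_on with
  | zero => simp only [map_zero, add_zero]
  | tmul a b => simp
  | add x y hx hy => rw [map_add, hx, hy, map_add, map_add]; abel

theorem galois_balanced (l : L) (n : N) (h : H) :
    𝓗.galois act hρ (act.act (𝓗.left.s l) n) h = 𝓗.galois act hρ n (𝓗.left.s l * h) := by
  have e := 𝓗.comulR_lactL l h
  simp only [LeftAct.mulLeft_act] at e
  rw [galois_apply, galois_apply]
  refine Eq.trans ?_ (congrArg _ e.symm)
  induction 𝓗.comulR h using BTensor.induction_on with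
  | zero => simp only [map_zero]
  | tmul a b => simp [act.mul_act]
  | add x y hx hy => simp only [map_add, hx, hy]

theorem galois_sL (l : L) (n : N) :
    𝓗.galois act hρ n (𝓗.left.s l) = BTensor.mk _ _ (act.act (𝓗.left.s l) n) 1 := by
  rw [galois_apply, comulR_sL]
  rfl

/-- This is the antipode axiom `h⁽¹⁾ S(h⁽²⁾) = s_L(ε_L(h))`, acting on `N`. -/
theorem contractS_galois (n : N) (h : H) :
    𝓗.contractS act hρ (𝓗.galois act hρ n h) = act.act (𝓗.left.s (𝓗.counitL h)) n := by
  rw [← 𝓗.id_mul_S h, galois_apply]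
  induction 𝓗.comulR h using BTensor.induction_on with
  | zero => simp only [map_zero, AddMonoidHom.zero_apply]
  | tmul a b => simp [act.mul_act]
  | add x y hx hy => simp only [map_add, hx, hy, AddMonoidHom.add_apply]

/-- Surjectivity of the Galois map: `n ⊗ h` is the image of `n S(h₍₁₎) ⊗ h₍₂₎`. -/
theorem galois_induction {p : BTensor ρ 𝓗.lactR → Prop} (z : BTensor ρ 𝓗.lactR) (zero : p 0)
    (galois : ∀ n h, p (𝓗.galois act hρ n h)) (add : ∀ x y, p x → p y → p (x + y)) : p z := by
  induction z using BTensor.induction_on with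
  | zero => exact zero
  | add x y hx hy => exact add x y hx hy
  | tmul n h =>
  -- `G(x ⊗ y)` is the image of `n S(x) ⊗ y`, and it is shown that `G(Δ_L(h)) = n ⊗ h`
  let G : BTensor 𝓗.ractL 𝓗.lactL →+ BTensor ρ 𝓗.lactR :=
    BTensor.lift (AddMonoidHom.mk' (fun x => 𝓗.galois act hρ (act.act (𝓗.S x) n))
      (fun x x' => by ext y; simp [galois_add]))
      (fun l x y => by simp [S_tL_mul, act.mul_act, galois_balanced])
  have hG : ∀ z, p (G z) := fun z => by
    induction z using BTensor.induction_on with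
    | zero => rw [map_zero]; exact zero
    | tmul x y => exact galois _ _
    | add x y hx hy => rw [map_add]; exact add _ _ hx hy
  let μS : BTensor 𝓗.ractL 𝓗.lactL →+ H :=
    BTensor.mulMap 𝓗.S.toAddMonoidHom (AddMonoidHom.id H)
      (fun l x y => by simp [S_tL_mul, mul_assoc])
  have hμS : ∀ r z, (act.act.flip n).comp μS
      ((BTensor.rightAct 𝓗.ractL 𝓗.lactL 𝓗.ractR 𝓗.ractR_lactL).act r z) =
        ρ.act r ((act.act.flip n).comp μS z) := fun r z => by
    induction z using BTensor.induction_on with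
    | zero => simp only [map_zero]
    | tmul x y => simp [μS, hρ, act.mul_act]
    | add x y hx hy => simp only [map_add, hx, hy]
  let K := BTensor.rTensor (ρ' := ρ) 𝓗.lactR ((act.act.flip n).comp μS) hμS
  have hK : ∀ z, G z = K (BTensor.insert 𝓗.ractL 𝓗.lactL 𝓗.ractR 𝓗.lactR 𝓗.ractR_lactL
      𝓗.comulR 𝓗.comulR_lactL z) := fun z => by
    induction z using BTensor.induction_on with
    | zero => simp only [map_zero]
    | tmul x y =>
      rw [BTensor.insert_mk]
      change 𝓗.galois act hρ (act.act (𝓗.S x) n) y = _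
      rw [galois_apply]
      induction 𝓗.comulR y using BTensor.induction_on with
      | zero => simp only [map_zero]
      | tmul a b => simp [K, μS, act.mul_act]
      | add x y hx hy => simp only [map_add, hx, hy]
    | add x y hx hy => simp only [map_add, hx, hy]
  have key : G (𝓗.comulL h) = BTensor.mk ρ 𝓗.lactR n h := by
    rw [hK, ← 𝓗.comulL_comulR]
    conv_rhs => rw [← 𝓗.right.coring.counit_left h]
    induction 𝓗.right.coring.comul h using BTensor.induction_on with
    | zero => simp only [map_zero]
    | tmul x y =>
      have e : μS (𝓗.comulL x) = 𝓗.right.s (𝓗.counitR x) := 𝓗.S_mul_id x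
      rw [BTensor.rTensor_mk, BTensor.rTensor_mk, BTensor.contractLeft_mk, ← BTensor.mk_balanced,
        hρ, AddMonoidHom.comp_apply, e]
      rfl
    | add x y hx hy => simp only [map_add, hx, hy]
  exact key ▸ hG _

/-! ### The diagonal action on `N ⊗_R H` -/

/-- The map `n ⊗ h ↦ n x⁽¹⁾ ⊗ h x⁽²⁾` on `N ⊗_R H`, which is well defined as `Δ_R` has its range in
the Takeuchi product. -/
def diagMap (x : H) : BTensor ρ 𝓗.lactR →+ BTensor ρ 𝓗.lactR :=
  takeuchiMulRight (ρA := 𝓗.ractR) (𝓗.right.s : R →+* H) (𝓗.right.t : Rᵐᵒᵖ →+* H)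
    (RightAct.mulRight_act _) act hρ (𝓗.comulR x) (takeuchi_right fun r => 𝓗.right.takeuchi r x)

theorem diagMap_mk (x : H) (n : N) (h : H) :
    𝓗.diagMap act hρ x (BTensor.mk ρ 𝓗.lactR n h) =
      BTensor.map (ρ := 𝓗.ractR) (lam := 𝓗.lactR) (act.act.flip n) (AddMonoidHom.mulLeft h)
        (𝓗.flip_ractR act hρ n) (LeftAct.mulLeft_mulRight _ h)
        (𝓗.comulR x) := rfl

/-- The diagonal right `H`-module structure `(n ⊗ h) x = n x⁽¹⁾ ⊗ h x⁽²⁾` on `N ⊗_R H`. -/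
def diagAct : RightAct H (BTensor ρ 𝓗.lactR) where
  act := AddMonoidHom.mk' (𝓗.diagMap act hρ)
    (fun x x' => BTensor.hom_ext fun n h => by
      rw [AddMonoidHom.add_apply, diagMap_mk, diagMap_mk, diagMap_mk, map_add, map_add])
  one_act z := by
    refine DFunLike.congr_fun (?_ : 𝓗.diagMap act hρ 1 = AddMonoidHom.id _) z
    refine BTensor.hom_ext fun n h => ?_
    rw [diagMap_mk, 𝓗.comulR_one, BTensor.map_mk]
    simp [act.one_act]
  mul_act x x' z := by
    refine DFunLike.congr_fun (f := 𝓗.diagMap act hρ (x * x'))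
      (g := (𝓗.diagMap act hρ x').comp (𝓗.diagMap act hρ x)) ?_ z
    refine BTensor.hom_ext fun n h => ?_
    rw [AddMonoidHom.comp_apply, diagMap_mk, diagMap_mk, 𝓗.right.comul_mul]
    induction 𝓗.right.coring.comul x using BTensor.induction_on with
    | zero => simp only [map_zero]
    | add x y hx hy => simp only [map_add, hx, hy]
    | tmul a b =>
      rw [takeuchiMulRight_mk, BTensor.map_mk, diagMap_mk]
      induction 𝓗.right.coring.comul x' using BTensor.induction_on with
      | zero => simp only [map_zero]
      | add x y hx hy => simp only [map_add, hx, hy]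
      | tmul a' b' => simp [act.mul_act, mul_assoc]

theorem diagAct_mk (x : H) (n : N) (h : H) :
    (𝓗.diagAct act hρ).act x (BTensor.mk ρ 𝓗.lactR n h) =
      BTensor.map (ρ := 𝓗.ractR) (lam := 𝓗.lactR) (act.act.flip n) (AddMonoidHom.mulLeft h)
        (𝓗.flip_ractR act hρ n) (LeftAct.mulLeft_mulRight _ h)
        (𝓗.comulR x) := rfl

theorem diagAct_mk_one (x : H) (n : N) :
    (𝓗.diagAct act hρ).act x (BTensor.mk ρ 𝓗.lactR n 1) = 𝓗.galois act hρ n x := by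
  rw [diagAct_mk, galois_apply]
  induction 𝓗.comulR x using BTensor.induction_on with
  | zero => simp only [map_zero]
  | tmul a b => simp
  | add x y hx hy => simp only [map_add, hx, hy]

/-- The right `R`-module structure of the diagonal `H`-module `N ⊗_R H` is that of the second
factor. -/
theorem rightAct_eq_diagAct (r : R) (z : BTensor ρ 𝓗.lactR) :
    (BTensor.rightAct ρ 𝓗.lactR 𝓗.ractR 𝓗.right.coring.act_comm).act r z =
      (𝓗.diagAct act hρ).act (𝓗.right.s r) z := by
  induction z using BTensor.induction_on with
  | zero => simp only [map_zero]
  | tmul n h =>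
    have e : 𝓗.comulR (𝓗.right.s r) = BTensor.mk _ _ 1 (𝓗.right.s r) := by
      simpa using 𝓗.right.comul_unit r 1
    rw [diagAct_mk, e]
    simp [act.one_act]
  | add x y hx hy => simp only [map_add, hx, hy]

theorem insert_comulR_galois (n : N) (h : H) :
    BTensor.insert ρ 𝓗.lactR 𝓗.ractR 𝓗.lactR 𝓗.right.coring.act_comm 𝓗.comulR
        𝓗.right.coring.comul_lact (𝓗.galois act hρ n h) =
      𝓗.galois (𝓗.diagAct act hρ) (𝓗.rightAct_eq_diagAct act hρ) (BTensor.mk _ _ n 1) h := by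
  rw [galois_apply, BTensor.insert_rTensor _ _ _ _ _ (BTensor.rTensor_rightAct _ _ _),
    ← 𝓗.right.coring.coassoc, galois_apply]
  induction 𝓗.right.coring.comul h using BTensor.induction_on with
  | zero => simp only [map_zero]
  | tmul a b =>
    rw [BTensor.rTensor_mk, BTensor.rTensor_mk, BTensor.rTensor_mk, AddMonoidHom.flip_apply,
      diagAct_mk_one, galois_apply]
  | add x y hx hy => simp only [map_add, hx, hy]

/-- `n S(h⁽²⁾)⁽¹⁾ ⊗ h⁽¹⁾ S(h⁽²⁾)⁽²⁾ = n S(h) ⊗ 1`. As the Galois map is surjective, it suffices to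
check this on its image, where it is `contractS_galois` for the diagonal module `N ⊗_R H`. -/
theorem contractS_insert_comulR (z : BTensor ρ 𝓗.lactR) :
    𝓗.contractS (𝓗.diagAct act hρ) (𝓗.rightAct_eq_diagAct act hρ)
        (BTensor.insert ρ 𝓗.lactR 𝓗.ractR 𝓗.lactR 𝓗.right.coring.act_comm 𝓗.comulR
          𝓗.right.coring.comul_lact z) =
      BTensor.mk ρ 𝓗.lactR (𝓗.contractS act hρ z) 1 := by
  induction z using 𝓗.galois_induction act hρ with
  | zero => simp only [map_zero, AddMonoidHom.zero_apply]
  | galois n h =>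
    rw [insert_comulR_galois, contractS_galois, contractS_galois, diagAct_mk_one, galois_sL]
  | add x y hx hy => simp only [map_add, hx, hy, AddMonoidHom.add_apply]

end Contraction

/-! ### Comodules -/

namespace Comodule

variable {k L R H M : Type*} [CommRing k] [Ring L] [Algebra k L] [Ring R] [Algebra k R] [Ring H]
  [Algebra k H] [AddCommGroup M] {𝓗 : HopfAlgebroid k L R H} (X : 𝓗.Comodule M)

/-- The coinvariants of the `H_R`-coaction are coinvariants of the `H_L`-coaction: the map
`m ⊗_R h ↦ m₍₀₎ ⊗_L m₍₁₎ S(h)` sends `ϱ_R(m)` to `m ⊗_L 1` and `m ⊗_R 1` to `ϱ_L(m)`. -/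
theorem coL_of_coR {m : M} (hm : X.coR.coact m = BTensor.mk _ _ m 1) :
    X.coL.coact m = BTensor.mk _ _ m 1 := by
  let δ : RightAct H (BTensor X.actL 𝓗.lactL) :=
    BTensor.rightAct X.actL 𝓗.lactL (RightAct.mulRight (RingHom.id H)) 𝓗.regular_lactL
  have hδ : ∀ r z, (BTensor.rightAct X.actL 𝓗.lactL 𝓗.ractR 𝓗.ractR_lactL).act r z =
      δ.act (𝓗.right.s r) z := fun r z =>
    DFunLike.congr_fun (f := (BTensor.rightAct X.actL 𝓗.lactL 𝓗.ractR 𝓗.ractR_lactL).act r)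
      (BTensor.hom_ext fun _ _ => rfl) z
  have key : ∀ z : BTensor X.actL 𝓗.lactL, 𝓗.contractS δ hδ
      (BTensor.insert X.actL 𝓗.lactL 𝓗.ractR 𝓗.lactR 𝓗.ractR_lactL 𝓗.comulR 𝓗.comulR_lactL z) =
      BTensor.mk X.actL 𝓗.lactL
        (BTensor.contractRight X.actL 𝓗.counitL 𝓗.left.coring.counit_lact z) 1 := fun z => by
    induction z using BTensor.induction_on with
    | zero => simp only [map_zero, AddMonoidHom.zero_apply]
    | add x y hx hy => simp only [map_add, hx, hy, AddMonoidHom.add_apply]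
    | tmul n h =>
      rw [BTensor.insert_mk, BTensor.contractRight_mk, BTensor.mk_balanced, LeftAct.mulLeft_act,
        mul_one]
      refine Eq.trans ?_ (congrArg (BTensor.mk X.actL 𝓗.lactL n) (𝓗.id_mul_S h))
      induction 𝓗.comulR h using BTensor.induction_on with
      | zero => simp only [map_zero]
      | tmul a b => rfl
      | add x y hx hy => simp only [map_add, hx, hy]
  have h1 := key (X.coL.coact m)
  rw [X.comulR_coL, hm, BTensor.rTensor_mk, contractS_mk, S_one, δ.one_act, X.coL.counit] at h1
  exact h1

/-- The inverse of a bijective morphism of comodules is a morphism of comodules. -/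
theorem IsHom.symm {N : Type*} [AddCommGroup N] {X : 𝓗.Comodule M} {Y : 𝓗.Comodule N}
    {f : M →+ N} (hf : IsHom X Y f) (g : N →+ M) (hfg : ∀ n, f (g n) = n)
    (hgf : ∀ m, g (f m) = m) : IsHom Y X g where
  map_actR r n := by rw [← hgf (X.actR.act r (g n)), hf.map_actR, hfg]
  map_actL l n := by rw [← hgf (X.actL.act l (g n)), hf.map_actL, hfg]
  coR n := by
    obtain ⟨m, rfl⟩ : ∃ m, f m = n := ⟨g n, hfg n⟩
    rw [hgf, hf.coR]
    induction X.coR.coact m using BTensor.induction_on with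
    | zero => simp only [map_zero]
    | tmul a b => simp only [BTensor.rTensor_mk, hgf]
    | add x y hx hy => rw [map_add, map_add, ← hx, ← hy]
  coL n := by
    obtain ⟨m, rfl⟩ : ∃ m, f m = n := ⟨g n, hfg n⟩
    rw [hgf, hf.coL]
    induction X.coL.coact m using BTensor.induction_on with
    | zero => simp only [map_zero]
    | tmul a b => simp only [BTensor.rTensor_mk, hgf]
    | add x y hx hy => rw [map_add, map_add, ← hx, ← hy]

end Comodule

/-! ### Coinvariants of Hopf modules -/

namespace HopfModule

variable {k L R H : Type*} [CommRing k] [Ring L] [Algebra k L] [Ring R] [Algebra k R] [Ring H]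
  [Algebra k H] {𝓗 : HopfAlgebroid k L R H} (M : HopfModule.{w} 𝓗.regular)

/-- `HopfModule.actR_eq` with the unit of the comodule algebra `H` unfolded. -/
theorem actR_eq_sR (r : R) (m : M.carrier) :
    M.comodule.actR.act r m = M.act.act (𝓗.right.s r) m := M.actR_eq r m

/-- The `H_R`-coinvariants of a Hopf module: all `m` with `ϱ_R(m) = m ⊗ 1`. -/
def coinv : AddSubgroup M.carrier where
  carrier := {m | M.comodule.coR.coact m = BTensor.mk _ _ m 1}
  zero_mem' := by simp
  add_mem' {a b} ha hb := by
    simp only [Set.mem_ofPred_eq] at ha hb ⊢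
    rw [map_add, ha, hb, map_add, AddMonoidHom.add_apply]
  neg_mem' {a} ha := by
    simp only [Set.mem_ofPred_eq] at ha ⊢
    rw [map_neg, ha, map_neg, AddMonoidHom.neg_apply]

/-- For a coinvariant `m`, the coaction `ϱ_R(m h)` is the value of the Galois map. -/
theorem coR_act_of_mem {m : M.carrier} (hm : m ∈ M.coinv) (h : H) :
    M.comodule.coR.coact (M.act.act h m) = 𝓗.galois M.act M.actR_eq_sR m h := by
  have e : M.comodule.coR.coact m = BTensor.mk _ _ m 1 := hm
  rw [← 𝓗.diagAct_mk_one M.act M.actR_eq_sR h m, ← e]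
  exact M.coR_act m h

/-- For a coinvariant `m`, `ϱ_L(m h) = m h₍₁₎ ⊗ h₍₂₎`. -/
theorem coL_act_of_mem {m : M.carrier} (hm : m ∈ M.coinv)
    (hl : ∀ l h, M.act.act.flip m (𝓗.ractL.act l h) = M.comodule.actL.act l (M.act.act.flip m h))
    (h : H) :
    M.comodule.coL.coact (M.act.act h m) =
      BTensor.rTensor (ρ' := M.comodule.actL) 𝓗.lactL (M.act.act.flip m) hl (𝓗.comulL h) := by
  have e := M.comodule.coL_of_coR hm
  refine (M.coL_act m h).trans ?_
  change takeuchiMulLeft _ _ _ _ _ _ _ (𝓗.comulL h) = _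
  induction 𝓗.comulL h using BTensor.induction_on with
  | zero => simp only [map_zero]
  | tmul a b =>
    refine (takeuchiMulLeft_mk _ _ _ _ _ _ _ _ _).trans ?_
    rw [e]
    simp
  | add x y hx hy => simp only [map_add, hx, hy]

/-- On coinvariants the right action of `L` is that of `t_L(L) ⊆ H`. -/
theorem actL_of_mem {m : M.carrier} (hm : m ∈ M.coinv) (l : L) :
    M.comodule.actL.act l m = M.act.act (𝓗.left.t (op l)) m := by
  have e : M.comodule.coR.coact m = BTensor.mk _ _ m 1 := hm
  rw [← M.comodule.coR.counit (M.comodule.actL.act l m), M.comodule.coR_actL, e,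
    BTensor.rightAct_mk, BTensor.contractRight_mk, M.actR_eq]
  change M.act.act (𝓗.right.s (𝓗.counitR (𝓗.left.t (op l) * 1))) m = _
  rw [mul_one, 𝓗.sR_counit_tL]

theorem flip_ractL_of_mem {m : M.carrier} (hm : m ∈ M.coinv) (l : L) (h : H) :
    M.act.act.flip m (𝓗.ractL.act l h) = M.comodule.actL.act l (M.act.act.flip m h) := by
  simp only [AddMonoidHom.flip_apply, RightAct.mulLeft_act, M.act.mul_act]
  rw [← M.act_actL, M.actL_of_mem hm]
  rfl

theorem act_sL_mem {m : M.carrier} (hm : m ∈ M.coinv) (l : L) :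
    M.act.act (𝓗.left.s l) m ∈ M.coinv := by
  change _ = _
  rw [M.coR_act_of_mem hm, galois_sL]

/-- The map `m ↦ m⁽⁰⁾ S(m⁽¹⁾)`, a projection onto the coinvariants. -/
def proj : M.carrier →+ M.carrier :=
  (𝓗.contractS M.act M.actR_eq_sR).comp M.comodule.coR.coact

theorem proj_of_mem {m : M.carrier} (hm : m ∈ M.coinv) : M.proj m = m := by
  have e : M.comodule.coR.coact m = BTensor.mk _ _ m 1 := hm
  rw [proj, AddMonoidHom.comp_apply, e, contractS_mk, S_one, M.act.one_act]

/-- The coassociativity of `ϱ_R` reduces the claim to `contractS_insert_comulR`. -/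
theorem proj_mem (m : M.carrier) : M.proj m ∈ M.coinv := by
  change M.comodule.coR.coact (𝓗.contractS M.act M.actR_eq_sR (M.comodule.coR.coact m)) =
    BTensor.mk _ _ (𝓗.contractS M.act M.actR_eq_sR (M.comodule.coR.coact m)) 1
  rw [← contractS_insert_comulR, ← M.comodule.coR.coassoc]
  induction M.comodule.coR.coact m using BTensor.induction_on with
  | zero => simp only [map_zero]
  | tmul a b => exact M.coR_act a (𝓗.S b)
  | add x y hx hy => simp only [map_add, hx, hy]

theorem proj_act_of_mem {m : M.carrier} (hm : m ∈ M.coinv) (h : H) :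
    M.proj (M.act.act h m) = M.act.act (𝓗.left.s (𝓗.counitL h)) m := by
  rw [proj, AddMonoidHom.comp_apply, M.coR_act_of_mem hm, contractS_galois]

theorem proj_actL (l : L) (m : M.carrier) :
    M.proj (M.comodule.actL.act l m) = M.act.act (𝓗.left.s l) (M.proj m) := by
  rw [proj, AddMonoidHom.comp_apply, AddMonoidHom.comp_apply, M.comodule.coR_actL]
  induction M.comodule.coR.coact m using BTensor.induction_on with
  | zero => simp only [map_zero]
  | tmul a b => simp [S_tL_mul, M.act.mul_act]
  | add x y hx hy => simp only [map_add, hx, hy]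

/-- The coinvariants form a right `L`-module via `s_L`. -/
instance coinvModule : Module Lᵐᵒᵖ M.coinv where
  smul l m := ⟨M.act.act (𝓗.left.s l.unop) m, M.act_sL_mem m.2 _⟩
  one_smul m := Subtype.ext (by
    change M.act.act (𝓗.left.s 1) _ = _
    rw [map_one, M.act.one_act])
  mul_smul a b m := Subtype.ext (by
    change M.act.act (𝓗.left.s (b.unop * a.unop)) _ = M.act.act _ (M.act.act _ _)
    rw [map_mul, M.act.mul_act])
  smul_zero a := Subtype.ext (map_zero _)
  smul_add a m m' := Subtype.ext (map_add _ _ _)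
  add_smul a b m := Subtype.ext (by
    change M.act.act (𝓗.left.s (a.unop + b.unop)) _ = M.act.act _ _ + M.act.act _ _
    rw [map_add, map_add, AddMonoidHom.add_apply])
  zero_smul m := Subtype.ext (by
    change M.act.act (𝓗.left.s 0) _ = 0
    rw [map_zero, map_zero, AddMonoidHom.zero_apply])

theorem coe_coinv_smul (l : Lᵐᵒᵖ) (m : M.coinv) :
    ((l • m : M.coinv) : M.carrier) = M.act.act (𝓗.left.s l.unop) m := rfl

/-! ### The counit of the adjunction -/

/-- The map `M^{co} ⊗_L H → M`, `m ⊗ h ↦ m h`. -/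
def counitMap : BTensor (RightAct.ofModule L M.coinv) 𝓗.lactL →+ M.carrier :=
  BTensor.lift (M.act.act.flip.comp M.coinv.subtype) (fun l m h => by
    simp [coe_coinv_smul, M.act.mul_act])

@[simp] theorem counitMap_mk (m : M.coinv) (h : H) :
    M.counitMap (BTensor.mk _ _ m h) = M.act.act h m := rfl

/-- The map `M → M^{co} ⊗_L H`, `m ↦ m₍₀₎⁽⁰⁾ S(m₍₀₎⁽¹⁾) ⊗ m₍₁₎`. -/
def counitInv : M.carrier →+ BTensor (RightAct.ofModule L M.coinv) 𝓗.lactL :=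
  (BTensor.rTensor (ρ' := RightAct.ofModule L M.coinv) 𝓗.lactL
    (M.proj.codRestrict M.coinv M.proj_mem)
    (fun l m => Subtype.ext (M.proj_actL l m))).comp M.comodule.coL.coact

/-- Mixed coassociativity turns `m₍₀₎⁽⁰⁾ S(m₍₀₎⁽¹⁾) m₍₁₎` into `m⁽⁰⁾ S(m⁽¹⁾₍₁₎) m⁽¹⁾₍₂₎`. -/
theorem counitMap_counitInv (m : M.carrier) : M.counitMap (M.counitInv m) = m := by
  -- `K((m ⊗_R h) ⊗_L h') = m S(h) h'`
  let K : BTensor (BTensor.rightAct M.comodule.actR 𝓗.lactR 𝓗.ractL 𝓗.ractL_lactR) 𝓗.lactL →+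
      M.carrier :=
    BTensor.lift (M.act.act.flip.comp (𝓗.contractS M.act M.actR_eq_sR)) (fun l z h => by
      induction z using BTensor.induction_on with
      | zero => simp only [map_zero, AddMonoidHom.zero_apply]
      | tmul a b => simp [S_tL_mul, M.act.mul_act]
      | add x y hx hy => simp only [map_add, hx, hy, AddMonoidHom.add_apply])
  have h1 : M.counitMap (M.counitInv m) = K (BTensor.rTensor 𝓗.lactL M.comodule.coR.coact
      M.comodule.coR_actL (M.comodule.coL.coact m)) := by
    rw [counitInv, AddMonoidHom.comp_apply]
    induction M.comodule.coL.coact m using BTensor.induction_on with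
    | zero => simp only [map_zero]
    | tmul a b => rfl
    | add x y hx hy => simp only [map_add, hx, hy]
  rw [h1, ← M.comodule.comulL_coR]
  refine Eq.trans ?_ (M.comodule.coR.counit m)
  induction M.comodule.coR.coact m using BTensor.induction_on with
  | zero => simp only [map_zero]
  | add x y hx hy => simp only [map_add, hx, hy]
  | tmul a h =>
    rw [BTensor.insert_mk, BTensor.contractRight_mk, M.actR_eq]
    refine Eq.trans ?_ (congrArg (fun x => M.act.act x a) (𝓗.S_mul_id h))
    induction 𝓗.comulL h using BTensor.induction_on with
    | zero => simp only [map_zero, AddMonoidHom.zero_apply]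
    | tmul x y => exact (M.act.mul_act _ _ _).symm
    | add x y hx hy => simp only [map_add, hx, hy, AddMonoidHom.add_apply]

/-- For a coinvariant `m` the left hand side is `m s_L(ε_L(h₍₁₎)) ⊗ h₍₂₎ = m ⊗ h`. -/
theorem counitInv_counitMap (z : BTensor (RightAct.ofModule L M.coinv) 𝓗.lactL) :
    M.counitInv (M.counitMap z) = z := by
  induction z using BTensor.induction_on with
  | zero => simp only [map_zero]
  | add x y hx hy => simp only [map_add, hx, hy]
  | tmul m h =>
    rw [counitMap_mk, counitInv, AddMonoidHom.comp_apply,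
      M.coL_act_of_mem m.2 (M.flip_ractL_of_mem m.2)]
    conv_rhs => rw [← 𝓗.left.coring.counit_left h]
    change _ = BTensor.mk _ _ m (BTensor.contractLeft _ _ _ (𝓗.comulL h))
    induction 𝓗.comulL h using BTensor.induction_on with
    | zero => simp only [map_zero]
    | add x y hx hy => simp only [map_add, hx, hy]
    | tmul x y =>
      have e : M.proj.codRestrict M.coinv M.proj_mem (M.act.act.flip (m : M.carrier) x) =
          op (𝓗.counitL x) • m := Subtype.ext (M.proj_act_of_mem m.2 x)
      rw [BTensor.rTensor_mk, BTensor.rTensor_mk, e, BTensor.contractLeft_mk,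
        ← BTensor.mk_balanced]
      rfl

theorem counitMap_actR (r : R) (z : BTensor (RightAct.ofModule L M.coinv) 𝓗.lactL) :
    M.counitMap ((𝓗.inducedComodule _).actR.act r z) =
      M.comodule.actR.act r (M.counitMap z) := by
  induction z using BTensor.induction_on with
  | zero => simp only [map_zero]
  | tmul m h => exact 𝓗.flip_ractR M.act M.actR_eq_sR (m : M.carrier) r h
  | add x y hx hy => simp only [map_add, hx, hy]

theorem counitMap_actL (l : L) (z : BTensor (RightAct.ofModule L M.coinv) 𝓗.lactL) :
    M.counitMap ((𝓗.inducedComodule _).actL.act l z) =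
      M.comodule.actL.act l (M.counitMap z) := by
  induction z using BTensor.induction_on with
  | zero => simp only [map_zero]
  | tmul m h => exact M.flip_ractL_of_mem m.2 l h
  | add x y hx hy => simp only [map_add, hx, hy]

theorem counitMap_act (a : H) (z : BTensor (RightAct.ofModule L M.coinv) 𝓗.lactL) :
    M.counitMap ((𝓗.inducedModule _).act.act a z) = M.act.act a (M.counitMap z) := by
  refine DFunLike.congr_fun (f := M.counitMap.comp ((𝓗.inducedModule _).act.act a))
    (g := (M.act.act a).comp M.counitMap) (BTensor.hom_ext fun m h => ?_) z
  exact M.act.mul_act h a m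

theorem counitMap_coR (z : BTensor (RightAct.ofModule L M.coinv) 𝓗.lactL) :
    M.comodule.coR.coact (M.counitMap z) =
      BTensor.rTensor (ρ' := M.comodule.actR) 𝓗.lactR M.counitMap M.counitMap_actR
        ((𝓗.inducedComodule _).coR.coact z) := by
  induction z using BTensor.induction_on with
  | zero => simp only [map_zero]
  | add x y hx hy => simp only [map_add, hx, hy]
  | tmul m h =>
    rw [counitMap_mk, M.coR_act_of_mem m.2, galois_apply]
    refine Eq.trans ?_ (congrArg _ (BTensor.insert_mk 𝓗.ractR 𝓗.lactR 𝓗.ractR_lactL 𝓗.comulR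
      𝓗.comulR_lactL m h).symm)
    change BTensor.rTensor _ _ _ (𝓗.comulR h) = BTensor.rTensor _ _ _
      (BTensor.tmulLeft _ _ _ _ _ m (𝓗.comulR h))
    induction 𝓗.comulR h using BTensor.induction_on with
    | zero => simp only [map_zero]
    | tmul a b => rfl
    | add x y hx hy => simp only [map_add, hx, hy]

theorem counitMap_coL (z : BTensor (RightAct.ofModule L M.coinv) 𝓗.lactL) :
    M.comodule.coL.coact (M.counitMap z) =
      BTensor.rTensor (ρ' := M.comodule.actL) 𝓗.lactL M.counitMap M.counitMap_actL
        ((𝓗.inducedComodule _).coL.coact z) := by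
  induction z using BTensor.induction_on with
  | zero => simp only [map_zero]
  | add x y hx hy => simp only [map_add, hx, hy]
  | tmul m h =>
    rw [counitMap_mk, M.coL_act_of_mem m.2 (M.flip_ractL_of_mem m.2)]
    refine Eq.trans ?_ (congrArg _ (BTensor.insert_mk 𝓗.ractL 𝓗.lactL 𝓗.left.coring.act_comm
      𝓗.comulL 𝓗.left.coring.comul_lact m h).symm)
    change BTensor.rTensor _ _ _ (𝓗.comulL h) = BTensor.rTensor _ _ _
      (BTensor.tmulLeft _ _ _ _ _ m (𝓗.comulL h))
    induction 𝓗.comulL h using BTensor.induction_on with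
    | zero => simp only [map_zero]
    | tmul a b => rfl
    | add x y hx hy => simp only [map_add, hx, hy]

/-- The Hopf module map `M^{co} ⊗_L H → M`. -/
def counitHom : Hom (𝓗.inducedModule (RightAct.ofModule L M.coinv)) M where
  toFun := M.counitMap
  map_act := M.counitMap_act
  isHom :=
    { map_actR := M.counitMap_actR
      map_actL := M.counitMap_actL
      coR := M.counitMap_coR
      coL := M.counitMap_coL }

theorem Hom.map_mem {M N : HopfModule.{w} 𝓗.regular} (f : Hom M N) {m : M.carrier}
    (hm : m ∈ M.coinv) : f.toFun m ∈ N.coinv := by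
  have e : M.comodule.coR.coact m = BTensor.mk _ _ m 1 := hm
  change _ = _
  rw [f.isHom.coR, e, BTensor.rTensor_mk]

end HopfModule

/-! ### Induced Hopf modules -/

section Induced

variable {k L R H : Type*} [CommRing k] [Ring L] [Algebra k L] [Ring R] [Algebra k R] [Ring H]
  [Algebra k H] (𝓗 : HopfAlgebroid k L R H) {W : Type w} [AddCommGroup W] (ρ : RightAct L W)

/-- The map `W ⊗_L ε_L : W ⊗_L H → W`. -/
def inducedCounit : BTensor ρ 𝓗.lactL →+ W :=
  BTensor.contractRight ρ 𝓗.counitL 𝓗.left.coring.counit_lact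

theorem inducedCounit_mk (w : W) (h : H) :
    𝓗.inducedCounit ρ (BTensor.mk _ _ w h) = ρ.act (𝓗.counitL h) w := rfl

theorem inducedCounit_mk_one (w : W) : 𝓗.inducedCounit ρ (BTensor.mk _ _ w 1) = w := by
  have e : 𝓗.counitL 1 = 1 := by simpa using 𝓗.counitL_sL 1
  rw [inducedCounit_mk, e, ρ.one_act]

theorem mk_one_mem_coinv (w : W) : BTensor.mk ρ 𝓗.lactL w 1 ∈ (𝓗.inducedModule ρ).coinv := by
  change BTensor.tmulLeft ρ 𝓗.lactL 𝓗.ractR 𝓗.lactR 𝓗.ractR_lactL w (𝓗.comulR 1) = _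
  rw [𝓗.comulR_one]
  rfl

theorem inducedModule_act_mk_one (w : W) (h : H) :
    (𝓗.inducedModule ρ).act.act h (BTensor.mk ρ 𝓗.lactL w 1) = BTensor.mk ρ 𝓗.lactL w h :=
  congrArg (BTensor.mk ρ 𝓗.lactL w) (one_mul h)

theorem inducedModule_proj (z : BTensor ρ 𝓗.lactL) :
    (𝓗.inducedModule ρ).proj z = BTensor.mk ρ 𝓗.lactL (𝓗.inducedCounit ρ z) 1 := by
  refine DFunLike.congr_fun (f := (𝓗.inducedModule ρ).proj)
    (g := ((BTensor.mk ρ 𝓗.lactL).flip 1).comp (𝓗.inducedCounit ρ))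
    (BTensor.hom_ext fun w h => ?_) z
  have e : BTensor.mk ρ 𝓗.lactL w (𝓗.left.s (𝓗.counitL h)) =
      BTensor.mk ρ 𝓗.lactL (ρ.act (𝓗.counitL h) w) 1 := by
    rw [BTensor.mk_balanced, LeftAct.mulLeft_act, mul_one]
    rfl
  refine (congrArg (𝓗.inducedModule ρ).proj (𝓗.inducedModule_act_mk_one ρ w h).symm).trans ?_
  refine (HopfModule.proj_act_of_mem _ (𝓗.mk_one_mem_coinv ρ w) h).trans ?_
  exact (𝓗.inducedModule_act_mk_one ρ w _).trans e

/-- The coinvariants of `W ⊗_L H` are the elements `w ⊗ 1`. -/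
theorem eq_mk_one_of_mem_coinv {z : BTensor ρ 𝓗.lactL} (hz : z ∈ (𝓗.inducedModule ρ).coinv) :
    z = BTensor.mk ρ 𝓗.lactL (𝓗.inducedCounit ρ z) 1 :=
  ((𝓗.inducedModule ρ).proj_of_mem hz).symm.trans (𝓗.inducedModule_proj ρ z)

end Induced

/-! ### The induction functor is an equivalence -/

section Equivalence

variable {k : Type uk} {L : Type uL} {R : Type uR} {H : Type uH} [CommRing k] [Ring L]
  [Algebra k L] [Ring R] [Algebra k R] [Ring H] [Algebra k H] (𝓗 : HopfAlgebroid k L R H)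

/-- A morphism `f` of `L`-modules is recovered from `f ⊗_L H` by restricting to `w ⊗ 1` and applying
`W ⊗_L ε_L`. -/
instance inductionFunctor_faithful : 𝓗.inductionFunctor.Faithful where
  map_injective {V W} f g hfg := by
    ext v
    have e : (𝓗.inductionFunctor.map f).toFun (BTensor.mk _ _ v 1) =
        (𝓗.inductionFunctor.map g).toFun (BTensor.mk _ _ v 1) := by rw [hfg]
    have e' := congrArg (𝓗.inducedCounit (RightAct.ofModule L W)) e
    exact (𝓗.inducedCounit_mk_one _ (f.hom v)).symm.trans
      (e'.trans (𝓗.inducedCounit_mk_one _ (g.hom v)))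

/-- A morphism of induced modules maps `v ⊗ 1` to a coinvariant, that is, to some `f(v) ⊗ 1`. -/
instance inductionFunctor_full : 𝓗.inductionFunctor.Full where
  map_surjective {V W} F := by
    let F' : BTensor (RightAct.ofModule L V) 𝓗.lactL →+ BTensor (RightAct.ofModule L W) 𝓗.lactL :=
      F.toFun
    have hF : ∀ v, F' (BTensor.mk _ _ v 1) =
        BTensor.mk _ _ (𝓗.inducedCounit _ (F' (BTensor.mk _ _ v 1))) 1 := fun v =>
      𝓗.eq_mk_one_of_mem_coinv _ (HopfModule.Hom.map_mem F (𝓗.mk_one_mem_coinv _ v))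
    have hF' : ∀ v h, F' (BTensor.mk _ _ v h) =
        BTensor.mk _ _ (𝓗.inducedCounit _ (F' (BTensor.mk _ _ v 1))) h := fun v h => by
      have e := F.map_act h (BTensor.mk _ _ v 1)
      refine (congrArg F' (𝓗.inducedModule_act_mk_one _ v h).symm).trans (e.trans ?_)
      refine (congrArg _ (hF v)).trans ?_
      exact 𝓗.inducedModule_act_mk_one _ _ h
    let f : V →ₗ[Lᵐᵒᵖ] W :=
      { toFun := fun v => 𝓗.inducedCounit _ (F' (BTensor.mk _ _ v 1))
        map_add' := fun v v' => by
          rw [map_add, AddMonoidHom.add_apply, map_add, map_add]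
        map_smul' := fun l v => by
          have e : BTensor.mk (RightAct.ofModule L V) 𝓗.lactL (l • v) 1 =
              BTensor.mk _ _ v (𝓗.left.s l.unop) := by
            have := BTensor.mk_balanced (ρ := RightAct.ofModule L V) (lam := 𝓗.lactL) l.unop v 1
            simpa using this
          rw [e, hF', inducedCounit_mk, counitL_sL]
          rfl }
    refine ⟨ModuleCat.ofHom f, HopfModule.Hom.ext (BTensor.hom_ext fun v h => ?_)⟩
    exact (hF' v h).symm

variable {𝓗} in
/-- Every Hopf module is induced from its coinvariants. -/
def HopfModule.counitIso (M : HopfModule.{max w uH} 𝓗.regular) :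
    𝓗.inducedModule (RightAct.ofModule L M.coinv) ≅ M where
  hom := M.counitHom
  inv :=
    { toFun := M.counitInv
      map_act := fun a m => by
        obtain ⟨z, rfl⟩ : ∃ z, M.counitMap z = m := ⟨_, M.counitMap_counitInv m⟩
        refine (congrArg M.counitInv (M.counitMap_act a z).symm).trans ?_
        exact (M.counitInv_counitMap _).trans (congrArg _ (M.counitInv_counitMap z).symm)
      isHom := M.counitHom.isHom.symm M.counitInv M.counitMap_counitInv M.counitInv_counitMap }
  hom_inv_id := HopfModule.Hom.ext (AddMonoidHom.ext M.counitInv_counitMap)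
  inv_hom_id := HopfModule.Hom.ext (AddMonoidHom.ext M.counitMap_counitInv)

instance inductionFunctor_essSurj : (inductionFunctor.{uk, uL, uR, uH, w} 𝓗).EssSurj where
  mem_essImage M := ⟨ModuleCat.of Lᵐᵒᵖ M.coinv, ⟨M.counitIso⟩⟩

end Equivalence

/-! ### The cleft extension `L ⊆ H` -/

section Coinvariants

variable {k L R H : Type*} [CommRing k] [Ring L] [Algebra k L] [Ring R] [Algebra k R] [Ring H]
  [Algebra k H] (𝓗 : HopfAlgebroid k L R H)

/-- If `Δ_R(b) = b ⊗ 1`, then `b = b S(1) = s_L(ε_L(b))`. -/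
theorem range_sL : Set.range 𝓗.left.s = 𝓗.regular.coinvariants := by
  apply Set.Subset.antisymm
  · rintro _ ⟨l, rfl⟩ a
    exact 𝓗.comulR_lactL l a
  · intro b hb
    have h1 : 𝓗.comulR b = BTensor.mk _ _ b 1 := by
      have h := hb 1
      rw [mul_one] at h
      refine h.trans ((congrArg _ 𝓗.comulR_one).trans ?_)
      exact congrArg (fun x => BTensor.mk 𝓗.ractR 𝓗.lactR x 1) (mul_one b)
    have h2 : b * 𝓗.S 1 = 𝓗.left.s (𝓗.counitL b) := by
      rw [← 𝓗.id_mul_S b, h1]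
      rfl
    exact ⟨𝓗.counitL b, by rw [← h2, S_one, mul_one]⟩

theorem range_tR : Set.range 𝓗.right.t = Set.range 𝓗.left.s := by
  apply Set.Subset.antisymm
  · rintro _ ⟨r, rfl⟩
    exact ⟨_, 𝓗.sL_counit_tR r⟩
  · rintro _ ⟨l, rfl⟩
    exact ⟨_, 𝓗.tR_counit_sL l⟩

/-- The extension of `L` by `H` is cleft: the antipode is the convolution inverse of the identity. -/
theorem isCleaving_id_S : 𝓗.regular.IsCleaving 𝓗.left.s LinearMap.id 𝓗.S where
  unitL_mem l := 𝓗.range_sL ▸ Set.mem_range_self l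
  j_left _ _ := rfl
  j_hom :=
    { map_actR := fun _ _ => rfl
      map_actL := fun _ _ => rfl
      coR := fun _ => (BTensor.rTensor_id _).symm
      coL := fun _ => (BTensor.rTensor_id _).symm }
  j'_bimod := 𝓗.S_bimod
  j_mul_j' := 𝓗.id_mul_S
  j'_mul_j := 𝓗.S_mul_id

end Coinvariants

end HopfAlgebroid

theorem mainTheorem2 {k : Type uk} {L : Type uL} {R : Type uR} {H : Type uH}
    [CommRing k] [Ring L] [Algebra k L] [Ring R] [Algebra k R] [Ring H] [Algebra k H]
    (𝓗 : HopfAlgebroid k L R H) :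
    (Function.Injective 𝓗.left.s ∧
      Set.range 𝓗.left.s = 𝓗.regular.coinvariants ∧
      Set.range 𝓗.right.t = 𝓗.regular.coinvariants) ∧
    𝓗.regular.IsCleaving 𝓗.left.s LinearMap.id 𝓗.S ∧
    (HopfAlgebroid.inductionFunctor.{uk, uL, uR, uH, w} 𝓗).IsEquivalence := by
  refine ⟨⟨Function.LeftInverse.injective 𝓗.counitL_sL, 𝓗.range_sL, 𝓗.range_tR.trans 𝓗.range_sL⟩,
    𝓗.isCleaving_id_S, ?_⟩
  exact {}
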